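/- Graphs are finite, undirected and without loops. For a vertex coloring $\chi\colon V(G)\to C$, view the vertex-colored graph $(G,\chi)$ as a relational structure with the edge relation and one unary predicate for each color in $C$. Let $C^2$ be the two-variable fragment of first-order logic (with equality) extended by the counting quantifiers $\exists^{\geq t}$ for $t\in\mathbb{N}$. A vertex-colored graph $(G,\chi)$ is \emph{identified} by $C^2$ if there is a sentence $\varphi$ of $C^2$ such that $(G,\chi)\models\varphi$ and every vertex-colored graph $(H,\eta)$, $\eta\colon V(H)\to C$, with $(H,\eta)\models\varphi$ is isomorphic to $(G,\chi)$ by a color-preserving graph isomorphism. Let $(G,\chi)$ be a vertex-colored graph that is identified by $C^2$, and let $\chi'\colon V(G)\to C'$ be a vertex coloring of $G$ that induces a (not necessarily strictly) finer partition of $V(G)$ than $\chi$ does, that is, $\chi'(u)=\chi'(v)$ implies $\chi(u)=\chi(v)$ for all $u,v\in V(G)$. Then $(G,\chi')$ is also identified by $C^2$. -/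

import Mathlib

/-- Formulas of the `k`-variable counting logic `C^k` over the vocabulary of graphs whose vertices
are colored with elements of `C`: equality, the edge relation and one unary predicate for each
color, the Boolean connectives, and the counting quantifiers `∃^{≥ t} x_i` for `t : ℕ`.
All variables, free or bound, come from the fixed set `{x_i | i : Fin k}` and can be reused.
Note that `∃` is `∃^{≥ 1}`, and `∀` is `¬ ∃^{≥ 1} ¬`. -/
inductive CountingFormula (k : ℕ) (C : Type*) : Type _ where
  | falsum : CountingFormula k C
  | eq (i j : Fin k) : CountingFormula k C
  | adj (i j : Fin k) : CountingFormula k C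
  | color (c : C) (i : Fin k) : CountingFormula k C
  | neg (φ : CountingFormula k C) : CountingFormula k C
  | and (φ ψ : CountingFormula k C) : CountingFormula k C
  | existsGE (t : ℕ) (i : Fin k) (φ : CountingFormula k C) : CountingFormula k C

namespace CountingFormula

/-- The set of (indices of) free variables of a formula. -/
def freeVars {k : ℕ} {C : Type*} : CountingFormula k C → Set (Fin k)
  | falsum => ∅
  | eq i j => {i, j}
  | adj i j => {i, j}
  | color _ i => {i}
  | neg φ => φ.freeVars
  | and φ ψ => φ.freeVars ∪ ψ.freeVars
  | existsGE _ i φ => φ.freeVars \ {i}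

/-- Satisfaction of a formula in the graph `G` with vertex coloring `χ`, under a partial assignment
`a` of vertices to variables. Partial assignments are used so that sentences can be evaluated
(under the nowhere defined assignment) in every graph, including the one without vertices.
The value is the usual one whenever all free variables of the formula are assigned. -/
def Holds {k : ℕ} {C V : Type*} (G : SimpleGraph V) (χ : V → C) :
    CountingFormula k C → (Fin k → Option V) → Prop
  | falsum, _ => False
  | eq i j, a => ∃ u v, a i = some u ∧ a j = some v ∧ u = v
  | adj i j, a => ∃ u v, a i = some u ∧ a j = some v ∧ G.Adj u v
  | color c i, a => ∃ u, a i = some u ∧ χ u = c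
  | neg φ, a => ¬ Holds G χ φ a
  | and φ ψ, a => Holds G χ φ a ∧ Holds G χ ψ a
  | existsGE t i φ, a =>
      (t : ℕ∞) ≤ Set.encard {v : V | Holds G χ φ (Function.update a i (some v))}

/-- A sentence is a formula without free variables. -/
def IsSentence {k : ℕ} {C : Type*} (φ : CountingFormula k C) : Prop :=
  φ.freeVars = ∅

/-- The vertex-colored graph `(G, χ)` is a model of the sentence `φ`. -/
def Models {k : ℕ} {C V : Type*} (G : SimpleGraph V) (χ : V → C) (φ : CountingFormula k C) : Prop :=
  Holds G χ φ (fun _ => none)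

end CountingFormula

/-- Isomorphism of vertex-colored graphs: a graph isomorphism that preserves colors. -/
def ColoredIso {C V W : Type*} (G : SimpleGraph V) (χ : V → C) (H : SimpleGraph W) (η : W → C) :
    Prop :=
  ∃ f : G ≃g H, ∀ v, η (f v) = χ v

/-- The vertex-colored graph `(G, χ)` is identified by `C^k`: it satisfies a sentence of `C^k` all
of whose models among finite vertex-colored graphs (with the same set of possible colors) are
isomorphic to `(G, χ)`. -/
def IsIdentified.{u, v} (k : ℕ) {V : Type u} {C : Type v} (G : SimpleGraph V) (χ : V → C) : Prop :=
  ∃ φ : CountingFormula k C, φ.IsSentence ∧ CountingFormula.Models G χ φ ∧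
    ∀ (W : Type u) [Finite W] (H : SimpleGraph W) (η : W → C),
      CountingFormula.Models H η φ → ColoredIso H η G χ

/-! Call an equitable partition `P` of `G` unigraphic if every graph on the same vertices with the
same numbers of neighbors in all cells is isomorphic to `G` by a map that preserves cells. Let `P`
be the partition into `C^2`-types (`vertexType`), the coarsest equitable partition finer than `χ`.
Graphs with the same degree parameters satisfy the same `C^2` formulas, by a back-and-forth
argument, and conversely the parameters can be written into a `C^2` sentence. Hence `(G, χ)` is
identified iff `P` is unigraphic (`IsIdentified.unigraphic`, `Unigraphic.isIdentified`). The types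
of `χ'` form an equitable refinement of `P`, so a combinatorial statement remains: an equitable
refinement `Q` of a unigraphic partition `P` is unigraphic (`Unigraphic.refine`).

Complementing between or inside cells of `P` affects neither side of this statement, so all
densities may be assumed at most one half. Two non-isomorphic realizations of the same degrees
contradict unigraphicity, which leaves little room. Between two cells one of the degrees is at most
1 (`Unigraphic.cellDegree_le_one`); inside a cell there are no edges, a perfect matching or a
pentagon (`Unigraphic.cellDegree_self`). Among the largest cells of any set of cells, the perfect
matchings between cells form a forest, and each tree of it carries at most one further relation (an
inner graph, or a partition induced by a smaller cell), because two of them could be superposed in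
inequivalent ways. So every nonempty set of cells contains one that is isolated, or edgeless and
pendant at one other cell (`Unigraphic.exists_removableCell`).

Given `H` with the same `Q`-degrees as `G`, such cells are stripped off one at a time and the
isomorphism is built in the reverse order: a pendant cell extends any map already constructed, and a
matching or a pentagon inside an isolated cell is determined together with its `Q`-classes. -/

set_option linter.unusedSectionVars false

/-! ### Degree parameters of vertex partitions, complementation and replacement between cells -/

section CellDegrees

open scoped Classical
open Finset

variable {V I J : Type*} [Fintype V]

/-- The number of neighbors of `v` in the cell `c` of the partition `P`. -/
noncomputable def cellDegree (G : SimpleGraph V) (P : V → I) (v : V) (c : I) : ℕ :=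
  #{u | G.Adj v u ∧ P u = c}

/-- The number of vertices in the cell `c`. -/
noncomputable def cellSize (P : V → I) (c : I) : ℕ := #{u | P u = c}

/-- The number of vertices other than `v` in the cell `c`. -/
noncomputable def cellOthers (P : V → I) (v : V) (c : I) : ℕ := #{u | u ≠ v ∧ P u = c}

/-- Every vertex has the same number of neighbors in each cell in both graphs. -/
def SameDegrees (G H : SimpleGraph V) (P : V → I) : Prop :=
  ∀ v c, cellDegree G P v c = cellDegree H P v c

/-- Vertices of the same cell have the same number of neighbors in every cell. -/
def Equitable (G : SimpleGraph V) (P : V → I) : Prop :=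
  ∀ u v c, P u = P v → cellDegree G P u c = cellDegree G P v c

/-- There is an isomorphism which maps every cell to itself. -/
def CellIso (G H : SimpleGraph V) (P : V → I) : Prop :=
  ∃ f : Equiv.Perm V, (∀ v, P (f v) = P v) ∧ ∀ u v, G.Adj u v ↔ H.Adj (f u) (f v)

/-- An equitable partition whose degree parameters determine the graph up to isomorphism. -/
structure Unigraphic (G : SimpleGraph V) (P : V → I) : Prop where
  equitable : Equitable G P
  cellIso : ∀ H, SameDegrees G H P → CellIso G H P

/-- No vertex is adjacent to more than half of the other vertices of a cell. -/
def Sparse (G : SimpleGraph V) (P : V → I) : Prop :=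
  ∀ v c, 2 * cellDegree G P v c ≤ cellOthers P v c

theorem SameDegrees.symm {G H : SimpleGraph V} {P : V → I} (h : SameDegrees G H P) :
    SameDegrees H G P := fun v c => (h v c).symm

theorem SameDegrees.trans {G H K : SimpleGraph V} {P : V → I} (h : SameDegrees G H P)
    (h' : SameDegrees H K P) : SameDegrees G K P := fun v c => (h v c).trans (h' v c)

theorem CellIso.symm {G H : SimpleGraph V} {P : V → I} (h : CellIso G H P) : CellIso H G P := by
  obtain ⟨f, hf, hf'⟩ := h
  refine ⟨f.symm, fun v => ?_, fun u v => ?_⟩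
  · rw [← hf (f.symm v), f.apply_symm_apply]
  · rw [hf', f.apply_symm_apply, f.apply_symm_apply]

theorem CellIso.trans {G H K : SimpleGraph V} {P : V → I} (h : CellIso G H P)
    (h' : CellIso H K P) : CellIso G K P := by
  obtain ⟨f, hf, hf'⟩ := h
  obtain ⟨g, hg, hg'⟩ := h'
  exact ⟨f.trans g, fun v => by simp [hg, hf], fun u v => by simp [hf', hg']⟩

theorem cellOthers_of_ne {P : V → I} {v : V} {c : I} (h : P v ≠ c) :
    cellOthers P v c = cellSize P c := by
  unfold cellOthers cellSize
  congr 1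
  ext u
  simp only [mem_filter, mem_univ, true_and, and_iff_right_iff_imp]
  rintro rfl rfl
  exact h rfl

theorem cellOthers_self_add_one (P : V → I) (v : V) :
    cellOthers P v (P v) + 1 = cellSize P (P v) := by
  unfold cellOthers cellSize
  have : ({u | P u = P v} : Finset V) = insert v ({u | u ≠ v ∧ P u = P v} : Finset V) := by
    ext u
    simp only [mem_filter, mem_univ, true_and, mem_insert]
    by_cases h : u = v <;> simp [h]
  rw [this, card_insert_of_notMem (by simp)]

theorem cellOthers_congr {P : V → I} {v w : V} (h : P v = P w) (c : I) :
    cellOthers P v c = cellOthers P w c := by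
  by_cases hc : P v = c
  · subst hc
    have h1 := cellOthers_self_add_one P v
    have h2 := cellOthers_self_add_one P w
    rw [h] at h1 ⊢
    omega
  · rw [cellOthers_of_ne hc, cellOthers_of_ne (h ▸ hc)]

theorem sum_cellDegree_comm (G : SimpleGraph V) (P : V → I) (X Y : I) :
    ∑ x with P x = X, cellDegree G P x Y = ∑ y with P y = Y, cellDegree G P y X := by
  have := sum_card_bipartiteAbove_eq_sum_card_bipartiteBelow (s := ({x | P x = X} : Finset V))
    (t := ({y | P y = Y} : Finset V)) G.Adj
  unfold bipartiteAbove bipartiteBelow at this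
  simp only [filter_filter] at this
  unfold cellDegree
  convert this using 4
  · rw [and_comm]
  · rw [G.adj_comm, and_comm]

theorem Equitable.double_count {G : SimpleGraph V} {P : V → I} (h : Equitable G P) (x y : V) :
    cellSize P (P x) * cellDegree G P x (P y) = cellSize P (P y) * cellDegree G P y (P x) := by
  have := sum_cellDegree_comm G P (P x) (P y)
  rw [sum_congr rfl (g := fun _ => cellDegree G P x (P y)) (by
      intro z hz; exact h _ _ _ (by simpa using hz)),
    sum_congr rfl (s₂ := ({y' | P y' = P y} : Finset V)) (g := fun _ => cellDegree G P y (P x)) (by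
      intro z hz; exact h _ _ _ (by simpa using hz))] at this
  simpa [cellSize] using this

theorem cellSize_pos (P : V → I) (v : V) : 0 < cellSize P (P v) :=
  card_pos.2 ⟨v, by simp⟩

theorem cellDegree_pos {G : SimpleGraph V} {P : V → I} {v : V} {c : I} :
    0 < cellDegree G P v c ↔ ∃ u, G.Adj v u ∧ P u = c := by
  unfold cellDegree
  rw [card_pos]
  simp [Finset.Nonempty]

/-- Degrees into the cells of a coarser partition. -/
theorem cellDegree_eq_sum {G : SimpleGraph V} {P : V → I} {Q : V → J}
    (hQ : ∀ u v, Q u = Q v → P u = P v) (v : V) (c : I) :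
    cellDegree G P v c = ∑ j ∈ ({u | P u = c} : Finset V).image Q, cellDegree G Q v j := by
  unfold cellDegree
  rw [card_eq_sum_card_fiberwise (f := Q) (t := ({u | P u = c} : Finset V).image Q)]
  · refine sum_congr rfl fun j hj => ?_
    congr 1
    obtain ⟨w, hw, rfl⟩ := mem_image.1 hj
    ext u
    simp only [mem_filter, mem_univ, true_and] at hw ⊢
    refine ⟨fun h => ⟨h.1.1, h.2⟩, fun h => ⟨⟨h.1, ?_⟩, h.2⟩⟩
    rw [hQ u w h.2, hw]
  · intro u hu
    simp only [coe_filter, mem_univ, true_and, Set.mem_ofPred_eq] at hu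
    simp only [coe_image, coe_filter, mem_univ, true_and]
    exact ⟨u, hu.2, rfl⟩

theorem SameDegrees.coarsen {G H : SimpleGraph V} {P : V → I} {Q : V → J}
    (hQ : ∀ u v, Q u = Q v → P u = P v) (h : SameDegrees G H Q) : SameDegrees G H P :=
  fun v c => by rw [cellDegree_eq_sum hQ, cellDegree_eq_sum hQ]; exact sum_congr rfl fun j _ => h v j

theorem SameDegrees.equitable {G H : SimpleGraph V} {P : V → I} (h : SameDegrees G H P)
    (hG : Equitable G P) : Equitable H P :=
  fun u v c huv => by rw [← h, ← h, hG u v c huv]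

theorem SameDegrees.unigraphic {G H : SimpleGraph V} {P : V → I} (h : SameDegrees G H P)
    (hG : Unigraphic G P) : Unigraphic H P :=
  ⟨h.equitable hG.equitable, fun _ hK => (hG.cellIso H h).symm.trans (hG.cellIso _ (h.trans hK))⟩

/-- Complement the graph between (and inside) the cells selected by `s`. -/
def flipCells (G : SimpleGraph V) (P : V → I) (s : Set (Sym2 I)) : SimpleGraph V where
  Adj u v := u ≠ v ∧ (G.Adj u v ↔ s(P u, P v) ∉ s)
  symm := ⟨fun u v h => ⟨h.1.symm, by rw [G.adj_comm, Sym2.eq_swap]; exact h.2⟩⟩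
  loopless := ⟨fun _ h => h.1 rfl⟩

theorem flipCells_adj {G : SimpleGraph V} {P : V → I} {s : Set (Sym2 I)} {u v : V} :
    (flipCells G P s).Adj u v ↔ u ≠ v ∧ (G.Adj u v ↔ s(P u, P v) ∉ s) := Iff.rfl

theorem flipCells_flipCells (G : SimpleGraph V) (P : V → I) (s : Set (Sym2 I)) :
    flipCells (flipCells G P s) P s = G := by
  ext u v
  simp only [flipCells_adj]
  have := G.ne_of_adj (a := u) (b := v)
  tauto

theorem CellIso.flip {G H : SimpleGraph V} {P : V → I} (s : Set (Sym2 I)) (Q : V → J)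
    (hQ : ∀ u v, Q u = Q v → P u = P v) (h : CellIso G H Q) :
    CellIso (flipCells G P s) (flipCells H P s) Q := by
  obtain ⟨f, hf, hf'⟩ := h
  refine ⟨f, hf, fun u v => ?_⟩
  simp only [flipCells_adj]
  rw [hf', hQ _ _ (hf u), hQ _ _ (hf v), f.injective.ne_iff]

theorem cellDegree_flipCells_of_mem (G : SimpleGraph V) {P : V → I} {s : Set (Sym2 I)} {Q : V → J}
    (hQ : ∀ u v, Q u = Q v → P u = P v) {v w : V} (h : s(P v, P w) ∈ s) :
    cellDegree (flipCells G P s) Q v (Q w) + cellDegree G Q v (Q w) = cellOthers Q v (Q w) := by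
  unfold cellDegree cellOthers
  rw [← card_union_of_disjoint]
  · congr 1
    ext u
    simp only [mem_union, mem_filter, mem_univ, true_and, flipCells_adj]
    constructor
    · rintro (⟨⟨h1, _⟩, h2⟩ | ⟨h1, h2⟩)
      · exact ⟨h1.symm, h2⟩
      · exact ⟨h1.ne.symm, h2⟩
    · rintro ⟨h1, h2⟩
      rw [hQ _ _ h2]
      have := h1.symm
      tauto
  · rw [disjoint_left]
    intro u hu hu'
    simp only [mem_filter, mem_univ, true_and, flipCells_adj] at hu hu'
    rw [hQ _ _ hu.2] at hu
    tauto

theorem cellDegree_flipCells_of_notMem (G : SimpleGraph V) {P : V → I} {s : Set (Sym2 I)}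
    {Q : V → J} (hQ : ∀ u v, Q u = Q v → P u = P v) {v w : V} (h : s(P v, P w) ∉ s) :
    cellDegree (flipCells G P s) Q v (Q w) = cellDegree G Q v (Q w) := by
  unfold cellDegree
  congr 1
  ext u
  simp only [mem_filter, mem_univ, true_and, flipCells_adj, and_congr_left_iff]
  intro hu
  rw [hQ _ _ hu]
  have := G.ne_of_adj (a := v) (b := u)
  tauto

/-- A flip either keeps a degree or replaces it by `cellOthers` minus the degree, and `cellOthers`
depends only on the cell. Two graphs and two vertices are allowed so that both `SameDegrees.flip`
and `Equitable.flip` are instances. -/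
theorem cellDegree_flipCells_congr {G H : SimpleGraph V} {P : V → I} (s : Set (Sym2 I)) {Q : V → J}
    (hQ : ∀ u v, Q u = Q v → P u = P v) {v w : V} (hvw : Q v = Q w) {c : J}
    (h : cellDegree G Q v c = cellDegree H Q w c) :
    cellDegree (flipCells G P s) Q v c = cellDegree (flipCells H P s) Q w c := by
  by_cases hc : ∃ z, Q z = c
  · obtain ⟨z, rfl⟩ := hc
    by_cases hs : s(P v, P z) ∈ s
    · have h1 := cellDegree_flipCells_of_mem G hQ hs
      have h2 := cellDegree_flipCells_of_mem H (s := s) hQ (v := w) (w := z)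
        (by rwa [← hQ v w hvw])
      have h3 := cellOthers_congr hvw (Q z)
      omega
    · rw [cellDegree_flipCells_of_notMem G hQ hs,
        cellDegree_flipCells_of_notMem H hQ (by rwa [← hQ v w hvw]), h]
  · have hz : ∀ (K : SimpleGraph V) x, cellDegree K Q x c = 0 := fun K x => by
      by_contra h0
      obtain ⟨u, -, hu⟩ := cellDegree_pos.1 (Nat.pos_of_ne_zero h0)
      exact hc ⟨u, hu⟩
    rw [hz, hz]

theorem SameDegrees.flip {G H : SimpleGraph V} {P : V → I} (s : Set (Sym2 I)) {Q : V → J}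
    (hQ : ∀ u v, Q u = Q v → P u = P v) (h : SameDegrees G H Q) :
    SameDegrees (flipCells G P s) (flipCells H P s) Q :=
  fun v c => cellDegree_flipCells_congr s hQ rfl (h v c)

theorem Equitable.flip {G : SimpleGraph V} {P : V → I} (s : Set (Sym2 I)) {Q : V → J}
    (hQ : ∀ u v, Q u = Q v → P u = P v) (h : Equitable G Q) : Equitable (flipCells G P s) Q :=
  fun u v c huv => cellDegree_flipCells_congr s hQ huv (h u v c huv)

theorem Unigraphic.flip {G : SimpleGraph V} {P : V → I} (s : Set (Sym2 I))
    (h : Unigraphic G P) : Unigraphic (flipCells G P s) P := by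
  refine ⟨h.equitable.flip s fun _ _ => id, fun H hH => ?_⟩
  have h1 := hH.flip s (P := P) fun _ _ => id
  rw [flipCells_flipCells] at h1
  have h2 := (h.cellIso _ h1).flip s P fun _ _ => id
  rwa [flipCells_flipCells] at h2

/-- Flip exactly the pairs of cells of density above one half. This is a property of unordered pairs
because the density between two cells is the same seen from either side. -/
theorem Equitable.exists_sparse_flipCells {G : SimpleGraph V} {P : V → I} (h : Equitable G P) :
    ∃ s, Sparse (flipCells G P s) P := by
  let s : Set (Sym2 I) := {z | ∃ x y, z = s(P x, P y) ∧
    cellOthers P x (P y) < 2 * cellDegree G P x (P y)}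
  have hs : ∀ x y, s(P x, P y) ∈ s → cellOthers P x (P y) < 2 * cellDegree G P x (P y) := by
    rintro x y ⟨x', y', he, hlt⟩
    rw [Sym2.eq_iff] at he
    rcases he with ⟨hx, hy⟩ | ⟨hx, hy⟩
    · rwa [hy, h x x' _ hx, cellOthers_congr hx]
    · rw [← hx, ← h y x' _ hy, ← cellOthers_congr hy] at hlt
      by_cases hxy : P x = P y
      · rwa [cellOthers_congr hxy, h x y _ hxy, ← hxy]
      · rw [cellOthers_of_ne (Ne.symm hxy)] at hlt
        rw [cellOthers_of_ne hxy]
        -- Counting the edges from both sides transfers the density bound from `y` to `x`.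
        have h1 := h.double_count x y
        have h2 := cellSize_pos P x
        have h3 := cellSize_pos P y
        by_contra hle
        push Not at hle
        nlinarith
  refine ⟨s, fun v c => ?_⟩
  by_cases hc : ∃ z, P z = c
  · obtain ⟨z, rfl⟩ := hc
    by_cases hz : s(P v, P z) ∈ s
    · have h1 := cellDegree_flipCells_of_mem G (s := s) (P := P) (fun _ _ => id) hz
      have h2 := hs v z hz
      omega
    · rw [cellDegree_flipCells_of_notMem G (P := P) (fun _ _ => id) hz]
      by_contra hlt
      exact hz ⟨v, z, rfl, not_le.1 hlt⟩
  · have : cellDegree (flipCells G P s) P v c = 0 := by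
      by_contra h0
      obtain ⟨u, -, hu⟩ := cellDegree_pos.1 (Nat.pos_of_ne_zero h0)
      exact hc ⟨u, hu⟩
    omega

/-- Replace the edges between the cells `X` and `Y` by those of `R`. -/
def replaceCells (G R : SimpleGraph V) (P : V → I) (X Y : I) : SimpleGraph V where
  Adj u v := if (P u = X ∧ P v = Y) ∨ (P u = Y ∧ P v = X) then R.Adj u v else G.Adj u v
  symm := ⟨fun u v h => by
    rw [R.adj_comm, G.adj_comm]
    exact (if_congr (by tauto) rfl rfl).mp h⟩
  loopless := ⟨fun _ h => by simp at h⟩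

theorem replaceCells_adj_of_mem {G R : SimpleGraph V} {P : V → I} {X Y : I} {u v : V}
    (hu : P u = X) (hv : P v = Y) : (replaceCells G R P X Y).Adj u v ↔ R.Adj u v := by
  simp [replaceCells, hu, hv]

theorem replaceCells_adj_of_ne {G R : SimpleGraph V} {P : V → I} {X Y : I} {u v : V}
    (h : s(P u, P v) ≠ s(X, Y)) : (replaceCells G R P X Y).Adj u v ↔ G.Adj u v := by
  rw [Ne, Sym2.eq_iff] at h
  simp [replaceCells, h]

/-- The source of the rival graphs used against `Unigraphic`: between two cells, or inside one, any
graph with the right degrees can be pasted in. -/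
theorem sameDegrees_replaceCells {G R : SimpleGraph V} {P : V → I} {X Y : I}
    (hX : ∀ u, P u = X → cellDegree R P u Y = cellDegree G P u Y)
    (hY : ∀ u, P u = Y → cellDegree R P u X = cellDegree G P u X) :
    SameDegrees G (replaceCells G R P X Y) P := by
  intro v c
  by_cases h : s(P v, c) = s(X, Y)
  · have h' : cellDegree G P v c = cellDegree R P v c := by
      rw [Sym2.eq_iff] at h
      rcases h with ⟨h1, h2⟩ | ⟨h1, h2⟩
      · rw [h2, hX v h1]
      · rw [h2, hY v h1]
    rw [h']
    unfold cellDegree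
    congr 1
    ext u
    simp only [mem_filter, mem_univ, true_and, and_congr_left_iff]
    rintro rfl
    rw [Sym2.eq_iff] at h
    simp [replaceCells, h]
  · unfold cellDegree
    congr 1
    ext u
    simp only [mem_filter, mem_univ, true_and, and_congr_left_iff]
    rintro rfl
    rw [replaceCells_adj_of_ne h]

theorem cellDegree_map_perm (G : SimpleGraph V) {P : V → I} (σ : Equiv.Perm V)
    (hσ : ∀ v, P (σ v) = P v) (v : V) (c : I) :
    cellDegree (G.comap σ) P v c = cellDegree G P (σ v) c := by
  unfold cellDegree
  refine card_bij (fun u _ => σ u) ?_ (fun _ _ _ _ h => σ.injective h) ?_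
  · intro u hu
    simpa [hσ] using hu
  · intro u hu
    refine ⟨σ.symm u, ?_, by simp⟩
    have : P (σ.symm u) = P u := by rw [← hσ, σ.apply_symm_apply]
    simpa [this] using hu

theorem Equitable.sameDegrees_comap {G : SimpleGraph V} {P : V → I} (h : Equitable G P)
    (σ : Equiv.Perm V) (hσ : ∀ v, P (σ v) = P v) : SameDegrees G (G.comap σ) P :=
  fun v c => by rw [cellDegree_map_perm G σ hσ]; exact h _ _ _ (hσ v).symm

end CellDegrees

/-! ### Non-isomorphic biregular bipartite graphs with equal parameters -/

section Biregular

open scoped Classical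
open Finset

/-- Number the edges from `0` to `m * a - 1`; edge `e` joins `e / a` on the left to `e % n` on the
right. Since `m * a = n * b`, each residue occurs `b` times, and `a ≤ n` keeps the `a` consecutive
residues at a left vertex distinct. -/
theorem exists_biregular {m n a b : ℕ} (ha : 0 < a) (han : a ≤ n) (h : m * a = n * b) :
    ∃ R : Fin m → Fin n → Prop, (∀ x, #{y | R x y} = a) ∧ ∀ y, #{x | R x y} = b := by
  refine ⟨fun i j => ∃ r < a, (i * a + r) % n = j, fun i => ?_, fun j => ?_⟩
  · have hn : 0 < n := by omega
    refine Eq.trans (Eq.symm ?_) (card_range a)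
    refine card_bij (fun r _ => ⟨(i * a + r) % n, Nat.mod_lt _ hn⟩) ?_ ?_ ?_
    · intro r hr
      simp only [mem_filter, mem_univ, true_and]
      exact ⟨r, mem_range.1 hr, rfl⟩
    · intro r hr r' hr' hrr
      simp only [mem_range, Fin.mk.injEq] at hr hr' hrr
      have h1 : r ≡ r' [MOD n] := Nat.ModEq.add_left_cancel' _ hrr
      exact h1.eq_of_lt_of_lt (by omega) (by omega)
    · intro j hj
      simp only [mem_filter, mem_univ, true_and] at hj
      obtain ⟨r, hr, hj⟩ := hj
      exact ⟨r, mem_range.2 hr, Fin.ext hj⟩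
  · have hlt : ∀ q : ℕ, q < b → q * n + j < m * a := fun q hq => by
      have := j.2
      have : (q + 1) * n ≤ b * n := Nat.mul_le_mul_right _ hq
      rw [h, mul_comm n b]
      linarith
    refine Eq.trans (Eq.symm ?_) (card_range b)
    refine card_bij (fun q hq => ⟨(q * n + j) / a, ?_⟩) ?_ ?_ ?_
    · exact Nat.div_lt_of_lt_mul (by rw [mul_comm a]; exact hlt q (mem_range.1 hq))
    · intro q hq
      simp only [mem_filter, mem_univ, true_and]
      refine ⟨(q * n + j) % a, Nat.mod_lt _ ha, ?_⟩
      rw [mul_comm, Nat.div_add_mod, mul_comm, Nat.mul_add_mod]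
      exact Nat.mod_eq_of_lt j.2
    · intro q hq q' hq' hqq
      simp only [Fin.mk.injEq] at hqq
      have h1 := Nat.div_add_mod (q * n + j) a
      have h2 := Nat.div_add_mod (q' * n + j) a
      have h3 := Nat.mod_lt (q * n + j) ha
      have h4 := Nat.mod_lt (q' * n + j) ha
      rw [hqq] at h1
      rcases lt_trichotomy q q' with hlt | heq | hlt
      · have : (q + 1) * n ≤ q' * n := Nat.mul_le_mul_right _ hlt
        rw [add_mul] at this
        omega
      · exact heq
      · have : (q' + 1) * n ≤ q * n := Nat.mul_le_mul_right _ hlt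
        rw [add_mul] at this
        omega
    · intro i hi
      simp only [mem_filter, mem_univ, true_and] at hi
      obtain ⟨r, hr, hj⟩ := hi
      have h1 := Nat.div_add_mod (i * a + r) n
      have h2 : i * a + r < n * b := by
        have : (i + 1) * a ≤ m * a := Nat.mul_le_mul_right _ i.2
        rw [← h]
        linarith
      refine ⟨(i * a + r) / n, mem_range.2 (Nat.div_lt_of_lt_mul h2), ?_⟩
      ext
      simp only
      rw [← hj, mul_comm, h1, mul_comm, Nat.mul_add_div ha, Nat.div_eq_of_lt hr, add_zero]

theorem card_filter_perm {α : Type*} [Fintype α] (p q : α → Prop) [DecidablePred p]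
    [DecidablePred q] (e : Equiv.Perm α)
    (h : ∀ x, p x ↔ q (e x)) : #{x | p x} = #{x | q x} := by
  refine card_bij (fun x _ => e x) ?_ (fun _ _ _ _ h => e.injective h) ?_
  · intro x hx
    simpa [h] using hx
  · intro x hx
    exact ⟨e.symm x, by simpa [h] using hx, by simp⟩

theorem card_filter_sum {α β : Type*} [Fintype α] [Fintype β] (p : α ⊕ β → Prop) :
    #{x | p x} = #{x | p (.inl x)} + #{x | p (.inr x)} := by
  simp only [card_filter]
  exact Fintype.sum_sum_type _

/-- In the rows `x₀`, `x₁` the switch acts as the transposition of `y₀` and `y₁`, and it leaves the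
other rows alone; the same holds for columns. -/
theorem card_switch {α β : Type*} [Fintype α] [Fintype β] {R S : α → β → Prop} {x₀ x₁ : α}
    {y₀ y₁ : β} (h00 : R x₀ y₀) (h11 : R x₁ y₁) (h01 : ¬ R x₀ y₁) (h10 : ¬ R x₁ y₀)
    (hS : ∀ x y, S x y ↔
      (R x y ↔ ¬ ((x = x₀ ∨ x = x₁) ∧ (y = y₀ ∨ y = y₁)))) :
    (∀ x, #{y | S x y} = #{y | R x y}) ∧ ∀ y, #{x | S x y} = #{x | R x y} := by
  have hx : x₀ ≠ x₁ := fun h => h10 (h ▸ h00)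
  have hy : y₀ ≠ y₁ := fun h => h01 (h ▸ h00)
  constructor
  · intro x
    by_cases hx : x = x₀ ∨ x = x₁
    · refine card_filter_perm _ _ (Equiv.swap y₀ y₁) fun y => ?_
      by_cases hy : y = y₀
      · subst hy
        rcases hx with rfl | rfl <;> simp [*]
      by_cases hy' : y = y₁
      · subst hy'
        rcases hx with rfl | rfl <;> simp [*]
      rw [Equiv.swap_apply_of_ne_of_ne hy hy']
      simp [hS, hy, hy']
    · simp [hS, hx]
  · intro y
    by_cases hy : y = y₀ ∨ y = y₁
    · refine card_filter_perm _ _ (Equiv.swap x₀ x₁) fun x => ?_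
      by_cases hx : x = x₀
      · subst hx
        rcases hy with rfl | rfl <;> simp [*]
      by_cases hx' : x = x₁
      · subst hx'
        rcases hy with rfl | rfl <;> simp [*]
      rw [Equiv.swap_apply_of_ne_of_ne hx hx']
      simp [hS, hx, hx']
    · simp [hS, hy]

/-- Two bipartite graphs are not isomorphic if one of them has fewer pairs of twins. -/
theorem not_iso_of_twins {α β : Type*} [Fintype α] {R S : α → β → Prop}
    (key : ∀ x x', (∀ y, S x y ↔ S x' y) → ∀ y, R x y ↔ R x' y) {x₀ x₁ : α}
    (hR : ∀ y, R x₀ y ↔ R x₁ y) (hS : ¬ ∀ y, S x₀ y ↔ S x₁ y) :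
    ¬ ∃ (f : Equiv.Perm α) (g : Equiv.Perm β), ∀ x y, R x y ↔ S (f x) (g y) := by
  rintro ⟨f, g, hfg⟩
  -- An isomorphism would map the twin pairs of `R` bijectively onto those of `S`, but the latter
  -- are a proper subset of the former.
  have hlt : #{p : α × α | ∀ y, S p.1 y ↔ S p.2 y} < #{p : α × α | ∀ y, R p.1 y ↔ R p.2 y} := by
    refine card_lt_card ((ssubset_iff_of_subset ?_).2 ⟨(x₀, x₁), by simpa using hR,
      by simpa using hS⟩)
    intro p hp
    simp only [mem_filter, mem_univ, true_and] at hp ⊢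
    exact key _ _ hp
  refine hlt.ne (card_filter_perm _ _ (f.prodCongr f) fun p => ?_).symm
  simp only [hfg, Equiv.prodCongr_apply, Prod.map_fst, Prod.map_snd]
  exact ⟨fun h y => by simpa using h (g.symm y), fun h y => h _⟩

/-- Two non-isomorphic biregular bipartite graphs with the same parameters. -/
theorem exists_biregular_not_iso_aux {a b m n : ℕ} (ha : 2 ≤ a) (hb : 2 ≤ b) (hbm : b ≤ m)
    (han : a ≤ n) (h : m * a = n * b) :
    ∃ R S : Fin b ⊕ Fin m → Fin a ⊕ Fin n → Prop,
      (∀ x, #{y | R x y} = a) ∧ (∀ y, #{x | R x y} = b) ∧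
      (∀ x, #{y | S x y} = a) ∧ (∀ y, #{x | S x y} = b) ∧
      ¬ ∃ (f : Equiv.Perm (Fin b ⊕ Fin m)) (g : Equiv.Perm (Fin a ⊕ Fin n)),
        ∀ x y, R x y ↔ S (f x) (g y) := by
  obtain ⟨C, hC, hC'⟩ := exists_biregular (by omega) han h
  -- `R` is a complete bipartite block next to a biregular graph `C`. Switching an edge of the block
  -- with an edge of `C` gives `S`, which has lost twins of the block.
  obtain ⟨R, hR1, hR2, hR3, hR4⟩ : ∃ R : Fin b ⊕ Fin m → Fin a ⊕ Fin n → Prop,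
      (∀ i j, R (.inl i) (.inl j)) ∧ (∀ i j, R (.inr i) (.inr j) ↔ C i j) ∧
      (∀ i j, ¬ R (.inl i) (.inr j)) ∧ (∀ i j, ¬ R (.inr i) (.inl j)) :=
    ⟨fun x y => Sum.elim (fun _ => Sum.elim (fun _ => True) (fun _ => False) y)
      (fun i => Sum.elim (fun _ => False) (fun j => C i j) y) x,
      by simp, by simp, by simp, by simp⟩
  have hR : ∀ x, #{y | R x y} = a := by
    rintro (i | i)
    · simp [card_filter_sum, hR1, hR3]
    · simp [card_filter_sum, hR2, hR4, ← hC i]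
  have hR' : ∀ y, #{x | R x y} = b := by
    rintro (j | j)
    · simp [card_filter_sum, hR1, hR4]
    · simp [card_filter_sum, hR2, hR3, ← hC' j]
  obtain ⟨j₁, hj₁⟩ : ({y | C ⟨0, by omega⟩ y} : Finset _).Nonempty := by
    rw [← card_pos, hC]; omega
  simp only [mem_filter, mem_univ, true_and] at hj₁
  set i₁ : Fin m := ⟨0, by omega⟩
  let i₀ : Fin b := ⟨0, by omega⟩
  let j₀ : Fin a := ⟨0, by omega⟩
  obtain ⟨S, hSR⟩ : ∃ S : Fin b ⊕ Fin m → Fin a ⊕ Fin n → Prop, ∀ x y, S x y ↔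
      (R x y ↔ ¬ ((x = .inl i₀ ∨ x = .inr i₁) ∧ (y = .inl j₀ ∨ y = .inr j₁))) :=
    ⟨_, fun _ _ => Iff.rfl⟩
  have hS := card_switch (x₀ := Sum.inl i₀) (x₁ := Sum.inr i₁) (y₀ := Sum.inl j₀)
    (y₁ := Sum.inr j₁)
    (hR1 _ _) ((hR2 _ _).2 hj₁) (hR3 _ _) (hR4 _ _) hSR
  refine ⟨R, S, hR, hR', fun x => (hS.1 x).trans (hR x),
    fun y => (hS.2 y).trans (hR' y), ?_⟩
  rintro ⟨f, g, hfg⟩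
  let j₂ : Fin a := ⟨1, by omega⟩
  let i₂ : Fin b := ⟨1, by omega⟩
  have hi : i₂ ≠ i₀ := by simp [i₂, i₀]
  have hj : j₂ ≠ j₀ := by simp [j₂, j₀]
  -- The untouched right vertex `j₂` of the block still separates the two left parts, and `i₁` is
  -- the only vertex outside the block that is adjacent to `j₀`. So the switch creates no twins.
  have key : ∀ x x', (∀ y, S x y ↔ S x' y) → ∀ y, R x y ↔ R x' y := by
    rintro (i | i) (i' | i') hxy
    · intro y; cases y <;> simp [hR1, hR3]
    · have := hxy (.inl j₂)
      simp [hSR, hR1, hR4, hj] at this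
    · have := hxy (.inl j₂)
      simp [hSR, hR1, hR4, hj] at this
    · have h0 := hxy (.inl j₀)
      have h1 : i = i₁ ↔ i' = i₁ := by simpa [hSR, hR4] using h0
      intro y
      have := hxy y
      simp only [hSR, reduceCtorEq, false_or, Sum.inr.injEq, h1] at this
      tauto
  refine not_iso_of_twins key (x₀ := Sum.inl i₀) (x₁ := Sum.inl i₂) ?_ ?_ ⟨f, g, hfg⟩
  · intro y; cases y <;> simp [hR1, hR3]
  · intro hy
    have := hy (.inl j₀)
    simp [hSR, hR1, hi] at this

theorem exists_biregular_not_iso {α β : Type*} [Fintype α] [Fintype β] {a b : ℕ} (ha : 2 ≤ a)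
    (hb : 2 ≤ b) (hα : 2 * b ≤ Fintype.card α) (hβ : 2 * a ≤ Fintype.card β)
    (h : Fintype.card α * a = Fintype.card β * b) :
    ∃ R S : α → β → Prop,
      (∀ x, #{y | R x y} = a) ∧ (∀ y, #{x | R x y} = b) ∧
      (∀ x, #{y | S x y} = a) ∧ (∀ y, #{x | S x y} = b) ∧
      ¬ ∃ (f : Equiv.Perm α) (g : Equiv.Perm β), ∀ x y, R x y ↔ S (f x) (g y) := by
  obtain ⟨m, hm⟩ := Nat.exists_eq_add_of_le (show b ≤ Fintype.card α by omega)
  obtain ⟨n, hn⟩ := Nat.exists_eq_add_of_le (show a ≤ Fintype.card β by omega)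
  obtain ⟨R, S, hR, hR', hS, hS', hne⟩ := exists_biregular_not_iso_aux ha hb (m := m) (n := n)
    (by omega) (by omega) (by rw [hm, hn] at h; linarith [mul_comm a b])
  let e : α ≃ Fin b ⊕ Fin m := Fintype.equivOfCardEq (by simp [hm])
  let e' : β ≃ Fin a ⊕ Fin n := Fintype.equivOfCardEq (by simp [hn])
  have aux : ∀ T : Fin b ⊕ Fin m → Fin a ⊕ Fin n → Prop, (∀ x, #{y | T x y} = a) →
      (∀ y, #{x | T x y} = b) → (∀ x, #{y | T (e x) (e' y)} = a) ∧
      ∀ y, #{x | T (e x) (e' y)} = b := by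
    intro T hT hT'
    constructor
    · intro x
      refine Eq.trans ?_ (hT (e x))
      exact card_bij (fun y _ => e' y) (by simp) (fun _ _ _ _ h => e'.injective h)
        fun y hy => ⟨e'.symm y, by simpa using hy, by simp⟩
    · intro y
      refine Eq.trans ?_ (hT' (e' y))
      exact card_bij (fun y _ => e y) (by simp) (fun _ _ _ _ h => e.injective h)
        fun y hy => ⟨e.symm y, by simpa using hy, by simp⟩
  refine ⟨fun x y => R (e x) (e' y), fun x y => S (e x) (e' y), (aux R hR hR').1, (aux R hR hR').2,
    (aux S hS hS').1, (aux S hS hS').2, ?_⟩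
  rintro ⟨f, g, hfg⟩
  refine hne ⟨(e.symm.trans f).trans e, (e'.symm.trans g).trans e', fun x y => ?_⟩
  have := hfg (e.symm x) (e'.symm y)
  simpa using this

end Biregular

/-! ### Non-isomorphic regular graphs with equal parameters -/

section Regular

open scoped Classical
open Finset

/-- Switching the edges `a b` and `c d` to `a d` and `c b` keeps the degrees. -/
theorem SimpleGraph.exists_switch {α : Type*} [Fintype α] (R : SimpleGraph α) {a b c d : α}
    (hab : R.Adj a b) (hcd : R.Adj c d) (had : ¬ R.Adj a d) (hcb : ¬ R.Adj c b) (had' : a ≠ d)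
    (hcb' : c ≠ b) : ∃ S : SimpleGraph α,
      (∀ x y, S.Adj x y ↔ (R.Adj x y ↔ ¬ (((x = a ∨ x = c) ∧ (y = b ∨ y = d)) ∨
        ((x = b ∨ x = d) ∧ (y = a ∨ y = c))))) ∧
      ∀ x, #{y | S.Adj x y} = #{y | R.Adj x y} := by
  have hab' := hab.ne
  have hcd' := hcd.ne
  have hac : a ≠ c := by rintro rfl; exact had hcd
  have hbd : b ≠ d := by rintro rfl; exact had hab
  obtain ⟨S, hS⟩ : ∃ S : SimpleGraph α, ∀ x y, S.Adj x y ↔ (R.Adj x y ↔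
      ¬ (((x = a ∨ x = c) ∧ (y = b ∨ y = d)) ∨ ((x = b ∨ x = d) ∧ (y = a ∨ y = c)))) :=
    ⟨{ Adj := fun x y => (R.Adj x y ↔ ¬ (((x = a ∨ x = c) ∧ (y = b ∨ y = d)) ∨
          ((x = b ∨ x = d) ∧ (y = a ∨ y = c))))
       symm := ⟨fun x y h => by rw [R.adj_comm]; tauto⟩
       loopless := ⟨fun x h => by
         have := R.irrefl (v := x)
         grind⟩ }, fun _ _ => Iff.rfl⟩
  refine ⟨S, hS, fun x => ?_⟩
  have hba := hab.symm
  have hdc := hcd.symm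
  rw [R.adj_comm] at had hcb
  have hda := had
  have hbc := hcb
  rw [R.adj_comm] at had hcb
  by_cases hx : x = a ∨ x = c
  · refine card_filter_perm _ _ (Equiv.swap b d) fun y => ?_
    by_cases hy : y = b
    · subst hy
      rcases hx with rfl | rfl <;> simp [*]
    by_cases hy' : y = d
    · subst hy'
      rcases hx with rfl | rfl <;> simp [*]
    rw [Equiv.swap_apply_of_ne_of_ne hy hy', hS]
    have : ¬ ((x = b ∨ x = d)) := by rcases hx with rfl | rfl <;> tauto
    tauto
  by_cases hx' : x = b ∨ x = d
  · refine card_filter_perm _ _ (Equiv.swap a c) fun y => ?_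
    by_cases hy : y = a
    · subst hy
      rcases hx' with rfl | rfl <;> simp [*]
    by_cases hy' : y = c
    · subst hy'
      rcases hx' with rfl | rfl <;> simp [*]
    rw [Equiv.swap_apply_of_ne_of_ne hy hy', hS]
    tauto
  · simp [hS, hx, hx']

/-- A circulant graph on `ZMod n`: differences at distance at most `d / 2` from `0`, together with
`n / 2` when `d` is odd, in which case `n` is even. -/
theorem exists_regular {n d : ℕ} (hd : d < n) (h : Even (n * d)) :
    ∃ R : SimpleGraph (Fin n), ∀ x, #{y | R.Adj x y} = d := by
  have : NeZero n := ⟨by omega⟩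
  let k := d / 2
  let T : ZMod n → Prop := fun x => x ≠ 0 ∧
    (x.val ≤ k ∨ n - k ≤ x.val ∨ (d % 2 = 1 ∧ 2 * x.val = n))
  have hT : ∀ x, T x → T (-x) := by
    rintro x ⟨h0, hx⟩
    have : NeZero x := ⟨h0⟩
    have hv := ZMod.val_neg_of_ne_zero x
    have hlt := ZMod.val_lt x
    refine ⟨neg_ne_zero.2 h0, ?_⟩
    rw [hv]
    omega
  have hcard : #{x | T x} = d := by
    have hpar : d % 2 = 1 → n % 2 = 0 := by
      intro h1
      rcases Nat.even_mul.1 h with h | h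
      · exact Nat.even_iff.1 h
      · have := Nat.even_iff.1 h; omega
    have h1 : #{x | T x} = #(Icc 1 k ∪ (Ico (n - k) n ∪ if d % 2 = 1 then {n / 2} else ∅)) := by
      refine card_bij (fun x _ => x.val) ?_ (fun _ _ _ _ h => ZMod.val_injective n h) ?_
      · intro x hx
        simp only [mem_filter, mem_univ, true_and, T] at hx
        have hlt := ZMod.val_lt x
        have h0 : x.val ≠ 0 := by rw [Ne, ZMod.val_eq_zero]; exact hx.1
        simp only [mem_union, mem_Icc, mem_Ico]
        split_ifs <;> simp <;> omega
      · intro v hv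
        simp only [mem_union, mem_Icc, mem_Ico] at hv
        have hv' : (1 ≤ v ∧ v ≤ k) ∨ (n - k ≤ v ∧ v < n) ∨ (d % 2 = 1 ∧ v = n / 2) := by
          split_ifs at hv with h2
          · simpa [h2] using hv
          · simpa [h2] using hv
        have hvn : v < n := by omega
        refine ⟨(v : ZMod n), ?_, ZMod.val_natCast_of_lt hvn⟩
        simp only [mem_filter, mem_univ, true_and, T]
        rw [ZMod.val_natCast_of_lt hvn, Ne, ← ZMod.val_eq_zero, ZMod.val_natCast_of_lt hvn]
        omega
    rw [h1, card_union_of_disjoint, card_union_of_disjoint]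
    · simp only [Nat.card_Icc, Nat.card_Ico]
      split_ifs <;> simp <;> omega
    · rw [disjoint_left]
      intro v hv
      simp only [mem_Ico] at hv
      split_ifs <;> simp
      omega
    · rw [disjoint_left]
      intro v hv
      simp only [mem_Icc, mem_union, mem_Ico] at hv ⊢
      split_ifs <;> simp <;> omega
  let e : Fin n ≃ ZMod n := Fintype.equivOfCardEq (by simp [ZMod.card])
  refine ⟨{ Adj := fun x y => T (e y - e x)
            symm := ⟨fun x y h => by simpa using hT _ h⟩
            loopless := ⟨fun x h => by simp [T] at h⟩ }, fun x => ?_⟩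
  refine Eq.trans ?_ hcard
  refine card_bij (fun y _ => e y - e x) ?_ ?_ ?_
  · intro y hy; simpa using hy
  · intro y _ y' _ h; simpa using h
  · intro t ht
    exact ⟨e.symm (t + e x), by simpa using ht, by simp⟩

/-- The vertices of a clique component are closed twins. Switching one of its edges with an edge of
the other component destroys some of these pairs and creates none. -/
theorem exists_regular_not_iso_clique {d m : ℕ} (hd : 2 ≤ d) (hm : d < m) (h : Even (m * d)) :
    ∃ R S : SimpleGraph (Fin (d + 1) ⊕ Fin m),
      (∀ x, #{y | R.Adj x y} = d) ∧ (∀ x, #{y | S.Adj x y} = d) ∧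
      ¬ ∃ f : Equiv.Perm (Fin (d + 1) ⊕ Fin m), ∀ x y, R.Adj x y ↔ S.Adj (f x) (f y) := by
  obtain ⟨C, hC⟩ := exists_regular hm h
  obtain ⟨R, hR1, hR2, hR3, hR4⟩ : ∃ R : SimpleGraph (Fin (d + 1) ⊕ Fin m),
      (∀ i j, R.Adj (.inl i) (.inl j) ↔ i ≠ j) ∧ (∀ i j, R.Adj (.inr i) (.inr j) ↔ C.Adj i j) ∧
      (∀ i j, ¬ R.Adj (.inl i) (.inr j)) ∧ (∀ i j, ¬ R.Adj (.inr i) (.inl j)) :=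
    ⟨(⊤ : SimpleGraph (Fin (d + 1))) ⊕g C, by simp, by simp, by simp, by simp⟩
  have hR : ∀ x, #{y | R.Adj x y} = d := by
    rintro (i | i)
    · simp [card_filter_sum, hR1, hR3, filter_ne]
    · simp [card_filter_sum, hR2, hR4, ← hC i]
  obtain ⟨j₁, hj₁⟩ : ({y | C.Adj ⟨0, by omega⟩ y} : Finset _).Nonempty := by
    rw [← card_pos, hC]; omega
  simp only [mem_filter, mem_univ, true_and] at hj₁
  set j₀ : Fin m := ⟨0, by omega⟩
  have hj := hj₁.ne
  obtain ⟨i₀, i₁, i₂, hi01, hi02, hi12⟩ : ∃ i₀ i₁ i₂ : Fin (d + 1), i₀ ≠ i₁ ∧ i₀ ≠ i₂ ∧ i₁ ≠ i₂ :=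
    ⟨⟨0, by omega⟩, ⟨1, by omega⟩, ⟨2, by omega⟩, by simp, by simp, by simp⟩
  obtain ⟨S, hSR, hS⟩ := R.exists_switch ((hR1 i₀ i₁).2 hi01) ((hR2 _ _).2 hj₁) (hR3 _ _)
    (hR4 _ _) (by simp) (by simp)
  refine ⟨R, S, hR, fun x => (hS x).trans (hR x), ?_⟩
  rintro ⟨f, hf⟩
  refine not_iso_of_twins (R := fun x y => x = y ∨ R.Adj x y) (S := fun x y => x = y ∨ S.Adj x y)
    ?_ (x₀ := Sum.inl i₀) (x₁ := Sum.inl i₂) ?_ ?_ ⟨f, f, fun x y => by simp [hf]⟩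
  · rintro (i | i) (i' | i') hxy
    · rintro (j | j)
      · simp only [Sum.inl.injEq, hR1]; tauto
      · simp [hR3]
    · have := hxy (.inl i₂)
      simp [hSR, hR1, hR4, hi02.symm, hi12.symm] at this
    · have := hxy (.inl i₂)
      simp [hSR, hR1, hR4, hi02.symm, hi12.symm] at this
    · have h0 := hxy (.inl i₀)
      have h1 := hxy (.inl i₁)
      have h0' : i = j₁ ↔ i' = j₁ := by simpa [hSR, hR4, hi01, hi01.symm] using h0
      have h1' : i = j₀ ↔ i' = j₀ := by simpa [hSR, hR4, hi01, hi01.symm] using h1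
      intro y
      by_cases hi0 : i = j₀
      · rw [hi0, h1'.1 hi0]
      by_cases hi1 : i = j₁
      · rw [hi1, h0'.1 hi1]
      have := hxy y
      simpa [hSR, hi0, hi1, ← h0', ← h1'] using this
  · rintro (j | j)
    · simp only [Sum.inl.injEq, hR1]; tauto
    · simp [hR3]
  · intro hy
    have := hy (.inl i₁)
    simp [hSR, hR1, hi01, hi02.symm, hi12.symm] at this

/-- For `4 * k + 1` vertices there is no room for a clique component and a second one. Instead take
two sides of `2 * k` vertices, half of them flagged, join the sides completely except for a perfect
matching between flagged vertices, and join `none` to the flagged vertices. Unflagged vertices of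
one side are twins; a switch among them makes two such twins adjacent. -/
theorem exists_regular_not_iso_bipartite {k : ℕ} (hk : 2 ≤ k) :
    ∃ R S : SimpleGraph (Option (Bool × Bool × Fin k)),
      (∀ x, #{y | R.Adj x y} = 2 * k) ∧ (∀ x, #{y | S.Adj x y} = 2 * k) ∧
      ¬ ∃ f : Equiv.Perm (Option (Bool × Bool × Fin k)),
        ∀ x y, R.Adj x y ↔ S.Adj (f x) (f y) := by
  obtain ⟨R, hR0, hR1, hR2, hR3⟩ : ∃ R : SimpleGraph (Option (Bool × Bool × Fin k)),
      (¬ R.Adj none none) ∧ (∀ s f i, R.Adj none (some (s, f, i)) ↔ f = true) ∧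
      (∀ s f i, R.Adj (some (s, f, i)) none ↔ f = true) ∧
      ∀ s f i s' f' i', R.Adj (some (s, f, i)) (some (s', f', i')) ↔
        s ≠ s' ∧ ¬ (f = true ∧ f' = true ∧ i = i') :=
    ⟨{ Adj := fun x y => x.elim (y.elim False fun q => q.2.1 = true) fun p =>
          y.elim (p.2.1 = true) fun q =>
            p.1 ≠ q.1 ∧ ¬ (p.2.1 = true ∧ q.2.1 = true ∧ p.2.2 = q.2.2)
       symm := ⟨by
         rintro (_ | ⟨s, f, i⟩) (_ | ⟨s', f', i'⟩) h
         · exact h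
         · exact h
         · exact h
         · exact ⟨h.1.symm, fun h' => h.2 ⟨h'.2.1, h'.1, h'.2.2.symm⟩⟩⟩
       loopless := ⟨by rintro (_ | ⟨s, f, i⟩) <;> simp⟩ }, by simp, by simp, by simp, by simp⟩
  have hsum : ∀ i : Fin k, (∑ x, if i = x then 0 else 1) = k - 1 := by
    intro i
    have := card_filter (fun x => i ≠ x) univ
    simp only [ne_eq, ite_not] at this
    rw [← this, filter_ne]
    simp
  have hR : ∀ x, #{y | R.Adj x y} = 2 * k := by
    intro x
    rw [card_filter, Fintype.sum_option, Fintype.sum_prod_type]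
    simp only [Fintype.sum_prod_type, Fintype.sum_bool]
    obtain _ | ⟨s, f, i⟩ := x
    · simp [hR1]
      omega
    · cases s <;> cases f <;> simp [hR2, hR3, hsum] <;> omega
  obtain ⟨i₀, i₁, hi⟩ : ∃ i₀ i₁ : Fin k, i₀ ≠ i₁ :=
    ⟨⟨0, by omega⟩, ⟨1, by omega⟩, by simp⟩
  obtain ⟨S, hSR, hS⟩ := R.exists_switch (a := some (false, false, i₀)) (b := some (true, false, i₀))
    (c := some (true, false, i₁)) (d := some (false, false, i₁)) (by simp [hR3]) (by simp [hR3])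
    (by simp [hR3]) (by simp [hR3]) (by simp [hi]) (by simp [hi.symm])
  refine ⟨R, S, hR, fun x => (hS x).trans (hR x), ?_⟩
  rintro ⟨f, hf⟩
  refine not_iso_of_twins (R := R.Adj) (S := S.Adj) ?_ (x₀ := some (false, false, i₀))
    (x₁ := some (false, false, i₁)) ?_ ?_ ⟨f, f, hf⟩
  · rintro (_ | ⟨s, f, i⟩) (_ | ⟨s', f', i'⟩) hxy
    · exact fun _ => Iff.rfl
    · have := hxy (some (s', true, i₀))
      simp [hSR, hR1, hR3] at this
    · have := hxy (some (s, true, i₀))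
      simp [hSR, hR1, hR3] at this
    -- The switch involves only unflagged vertices, so adjacency to `none` and to flagged vertices
    -- is as in `R`. It determines the side, the flag and, for flagged vertices, the index.
    · have hn : f = true ↔ f' = true := by simpa [hSR, hR2] using hxy none
      have ht : ∀ t j, (s ≠ t ∧ ¬ (f = true ∧ i = j)) ↔ (s' ≠ t ∧ ¬ (f' = true ∧ i' = j)) := by
        intro t j
        simpa [hSR, hR3] using hxy (some (t, true, j))
      obtain ⟨j, hj⟩ : ∃ j, i ≠ j := by
        by_cases h : i = i₀
        · exact ⟨i₁, h ▸ hi⟩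
        · exact ⟨i₀, h⟩
      have hs : s = s' := by
        have := (ht (!s) j).1 ⟨by simp, fun h => hj h.2⟩
        simpa using this.1.symm
      subst hs
      have hff : f = f' := Bool.eq_iff_iff.2 hn
      subst hff
      cases f
      · rintro (_ | ⟨t, g, j⟩) <;> simp [hR2, hR3]
      · have := ht (!s) i
        have : i' = i := by simpa using this
        rw [this]
        exact fun _ => Iff.rfl
  · rintro (_ | ⟨s, f, i⟩) <;> simp [hR2, hR3]
  · intro hy
    have := hy (some (false, false, i₁))
    simp [hSR, hR3, hi, hi.symm] at this

/-- Beyond `2 * d + 1` vertices the clique construction fits. With exactly `2 * d + 1` vertices `d`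
is even and the second construction applies, except for the pentagon, where it would need `k = 1`.
-/
theorem exists_regular_not_iso {α : Type*} [Fintype α] {d : ℕ} (hd : 2 ≤ d)
    (hα : 2 * d + 1 ≤ Fintype.card α) (h : Even (Fintype.card α * d))
    (h5 : ¬ (Fintype.card α = 5 ∧ d = 2)) :
    ∃ R S : SimpleGraph α, (∀ x, #{y | R.Adj x y} = d) ∧ (∀ x, #{y | S.Adj x y} = d) ∧
      ¬ ∃ f : Equiv.Perm α, ∀ x y, R.Adj x y ↔ S.Adj (f x) (f y) := by
  suffices ∃ (β : Type) (_ : Fintype β), Fintype.card β = Fintype.card α ∧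
      ∃ R S : SimpleGraph β, (∀ x, #{y | R.Adj x y} = d) ∧ (∀ x, #{y | S.Adj x y} = d) ∧
      ¬ ∃ f : Equiv.Perm β, ∀ x y, R.Adj x y ↔ S.Adj (f x) (f y) by
    obtain ⟨β, _, hβ, R, S, hR, hS, hRS⟩ := this
    let e : α ≃ β := Fintype.equivOfCardEq hβ.symm
    have aux : ∀ T : SimpleGraph β, (∀ x, #{y | T.Adj x y} = d) →
        ∀ x, #{y | (T.comap e).Adj x y} = d := by
      intro T hT x
      refine Eq.trans ?_ (hT (e x))
      exact card_bij (fun y _ => e y) (by simp) (fun _ _ _ _ h => e.injective h)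
        fun y hy => ⟨e.symm y, by simpa using hy, by simp⟩
    refine ⟨R.comap e, S.comap e, aux R hR, aux S hS, ?_⟩
    rintro ⟨f, hf⟩
    refine hRS ⟨(e.symm.trans f).trans e, fun x y => ?_⟩
    have := hf (e.symm x) (e.symm y)
    simpa using this
  obtain hlt | heq := Nat.lt_or_eq_of_le hα
  · obtain ⟨m, hm⟩ := Nat.exists_eq_add_of_le (show d + 1 ≤ Fintype.card α by omega)
    refine ⟨Fin (d + 1) ⊕ Fin m, inferInstance, by simp [hm],
      exists_regular_not_iso_clique hd (by omega) ?_⟩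
    rw [hm, add_mul, Nat.even_add] at h
    have h2 := Nat.even_mul_succ_self d
    rw [mul_comm] at h2
    exact h.1 h2
  · have hev : Even d := by
      rw [← heq, Nat.even_mul] at h
      rcases h with h | h
      · rw [Nat.even_iff] at h; omega
      · exact h
    obtain ⟨k, rfl⟩ := hev.two_dvd
    refine ⟨Option (Bool × Bool × Fin k), inferInstance, ?_,
      exists_regular_not_iso_bipartite (by omega)⟩
    simp
    omega

end Regular

/-! ### Superposing two symmetric relations on one set -/

section TwoRelations

open scoped Classical
open Finset

/-- A relation that separates two pairs of points. -/
def HasAlternatingSquare {α : Type*} (E : α → α → Prop) : Prop :=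
  ∃ p q r s, p ≠ r ∧ q ≠ s ∧ p ≠ s ∧ q ≠ r ∧ E p r ∧ E q s ∧ ¬ E p s ∧ ¬ E q r

theorem exists_equiv_map_four {α β : Type*} [Finite β] (e : α ≃ β) {p q r s : α} {p' q' r' s' : β}
    (h : [p, q, r, s].Nodup) (h' : [p', q', r', s'].Nodup) :
    ∃ ρ : α ≃ β, ρ p = p' ∧ ρ q = q' ∧ ρ r = r' ∧ ρ s = s' := by
  have h1 : Function.Injective ![e p, e q, e r, e s] := by
    rw [← List.nodup_ofFn]
    simpa [List.ofFn_succ] using h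
  have h2 : Function.Injective ![p', q', r', s'] := by
    rw [← List.nodup_ofFn]
    simpa [List.ofFn_succ] using h'
  obtain ⟨g, hg⟩ := (Equiv.Perm.isMultiplyPretransitive β 4).exists_smul_eq
    (⟨_, h1⟩ : Fin 4 ↪ β) ⟨_, h2⟩
  have hg' := fun i => DFunLike.congr_fun hg i
  exact ⟨e.trans g, by simpa using hg' 0, by simpa using hg' 1, by simpa using hg' 2,
    by simpa using hg' 3⟩

/-- A mixed second difference of `F` under the transpositions `p q` and `r s`. It vanishes at pairs
not joining `{p, q}` to `{r, s}`; among the joining pairs it is positive where `F` holds and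
negative where it fails. There `E` and `F` agree, so only positive terms survive. -/
theorem sum_alternating_pos {α : Type*} [Fintype α] {E F : α → α → Prop} (hE : ∀ ⦃x y⦄, E x y → E y x)
    (hF : ∀ ⦃x y⦄, F x y → F y x) {p q r s : α} (h : [p, q, r, s].Nodup) (h1 : E p r) (h2 : E q s)
    (h3 : ¬ E p s) (h4 : ¬ E q r) (h1' : F p r) (h2' : F q s) (h3' : ¬ F p s) (h4' : ¬ F q r) :
    0 < ∑ z : α × α, (if E z.1 z.2 then (1 : ℤ) else 0) *
      ((if F z.1 z.2 then 1 else 0)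
        - (if F (Equiv.swap p q z.1) (Equiv.swap p q z.2) then 1 else 0)
        - (if F (Equiv.swap r s z.1) (Equiv.swap r s z.2) then 1 else 0)
        + (if F (Equiv.swap p q (Equiv.swap r s z.1)) (Equiv.swap p q (Equiv.swap r s z.2))
            then 1 else 0)) := by
  simp only [List.nodup_cons, List.mem_cons, List.not_mem_nil, or_false, not_or] at h
  obtain ⟨⟨hpq, hpr, hps⟩, ⟨hqr, hqs⟩, hrs, -⟩ := h
  have hpr' := Ne.symm hpr
  have hps' := Ne.symm hps
  have hqr' := Ne.symm hqr
  have hqs' := Ne.symm hqs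
  have g1 := hF h1'
  have g2 := hF h2'
  have g3 : ¬ F s p := fun hh => h3' (hF hh)
  have g4 : ¬ F r q := fun hh => h4' (hF hh)
  have k3 : ¬ E s p := fun hh => h3 (hE hh)
  have k4 : ¬ E r q := fun hh => h4 (hE hh)
  refine sum_pos' ?_ ⟨(p, r), mem_univ _, ?_⟩
  · rintro ⟨u, v⟩ -
    simp only
    by_cases hrs : (u ≠ r ∧ u ≠ s) ∧ v ≠ r ∧ v ≠ s
    · rw [Equiv.swap_apply_of_ne_of_ne hrs.1.1 hrs.1.2, Equiv.swap_apply_of_ne_of_ne hrs.2.1 hrs.2.2]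
      simp
    by_cases hpq : (u ≠ p ∧ u ≠ q) ∧ v ≠ p ∧ v ≠ q
    · have hu : Equiv.swap r s u ≠ p ∧ Equiv.swap r s u ≠ q := by
        rw [Equiv.swap_apply_def]; split_ifs <;> tauto
      have hv : Equiv.swap r s v ≠ p ∧ Equiv.swap r s v ≠ q := by
        rw [Equiv.swap_apply_def]; split_ifs <;> tauto
      rw [Equiv.swap_apply_of_ne_of_ne hpq.1.1 hpq.1.2, Equiv.swap_apply_of_ne_of_ne hpq.2.1 hpq.2.2,
        Equiv.swap_apply_of_ne_of_ne hu.1 hu.2, Equiv.swap_apply_of_ne_of_ne hv.1 hv.2]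
      simp
    have hcases : ((u = p ∨ u = q) ∧ (v = r ∨ v = s)) ∨ ((u = r ∨ u = s) ∧ (v = p ∨ v = q)) := by
      grind
    rcases hcases with ⟨rfl | rfl, rfl | rfl⟩ | ⟨rfl | rfl, rfl | rfl⟩ <;>
      simp [*, Equiv.swap_apply_of_ne_of_ne]
  · simp [*, Equiv.swap_apply_of_ne_of_ne]

/-- The number of common pairs of two relations depends on how they are superposed. -/
theorem HasAlternatingSquare.exists_equiv_card_ne {α β : Type*} [Fintype α] [Finite β]
    {E : α → α → Prop} {F : β → β → Prop} (hE : ∀ ⦃x y⦄, E x y → E y x) (hF : ∀ ⦃x y⦄, F x y → F y x)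
    (hE' : HasAlternatingSquare E) (hF' : HasAlternatingSquare F) (e : α ≃ β) :
    ∃ σ τ : α ≃ β, #{z : α × α | E z.1 z.2 ∧ F (σ z.1) (σ z.2)} ≠
      #{z : α × α | E z.1 z.2 ∧ F (τ z.1) (τ z.2)} := by
  obtain ⟨p, q, r, s, hpr, hqs, hps, hqr, h1, h2, h3, h4⟩ := hE'
  obtain ⟨p', q', r', s', hpr', hqs', hps', hqr', h1', h2', h3', h4'⟩ := hF'
  have hnd : [p, q, r, s].Nodup := by
    have hpq : p ≠ q := by rintro rfl; exact h3 h2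
    have hrs : r ≠ s := by rintro rfl; exact h3 h1
    simp [*]
  have hnd' : [p', q', r', s'].Nodup := by
    have hpq : p' ≠ q' := by rintro rfl; exact h3' h2'
    have hrs : r' ≠ s' := by rintro rfl; exact h3' h1'
    simp [*]
  -- Align the two alternating squares. If all superpositions had the same count `c`, the
  -- alternating sum would be `c - c - c + c = 0`.
  obtain ⟨ρ, rfl, rfl, rfl, rfl⟩ := exists_equiv_map_four e hnd hnd'
  by_contra! hall
  have hpos := sum_alternating_pos (F := fun u v => F (ρ u) (ρ v)) hE (fun _ _ h => hF h) hnd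
    h1 h2 h3 h4 h1' h2' h3' h4'
  have hc : ∀ σ : α → β, ((#{z : α × α | E z.1 z.2 ∧ F (σ z.1) (σ z.2)} : ℕ) : ℤ) =
      ∑ z : α × α, (if E z.1 z.2 then (1 : ℤ) else 0) * (if F (σ z.1) (σ z.2) then 1 else 0) := by
    intro σ
    rw [card_filter]
    push_cast
    refine sum_congr rfl fun z _ => ?_
    by_cases h : E z.1 z.2 <;> simp [h]
  beta_reduce at hpos
  simp only [mul_add, mul_sub, sum_add_distrib, sum_sub_distrib] at hpos
  have e2 :
      #{z : α × α | E z.1 z.2 ∧ F (ρ (Equiv.swap p q z.1)) (ρ (Equiv.swap p q z.2))}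
        = #{z : α × α | E z.1 z.2 ∧ F (ρ z.1) (ρ z.2)} :=
    hall ((Equiv.swap p q).trans ρ) ρ
  have e3 :
      #{z : α × α | E z.1 z.2 ∧ F (ρ (Equiv.swap r s z.1)) (ρ (Equiv.swap r s z.2))}
        = #{z : α × α | E z.1 z.2 ∧ F (ρ z.1) (ρ z.2)} :=
    hall ((Equiv.swap r s).trans ρ) ρ
  have e4 :
      #{z : α × α | E z.1 z.2 ∧ F (ρ (Equiv.swap p q (Equiv.swap r s z.1))) (ρ (Equiv.swap p q (Equiv.swap r s z.2)))}
        = #{z : α × α | E z.1 z.2 ∧ F (ρ z.1) (ρ z.2)} :=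
    hall (((Equiv.swap r s).trans (Equiv.swap p q)).trans ρ) ρ
  have h1 := hc ρ
  have h2 := hc fun z => ρ (Equiv.swap p q z)
  have h3 := hc fun z => ρ (Equiv.swap r s z)
  have h4 := hc fun z => ρ (Equiv.swap p q (Equiv.swap r s z))
  beta_reduce at h1 h2 h3 h4
  rw [← h1, ← h2, ← h3, ← h4] at hpos
  omega

end TwoRelations

/-! ### Edges between and inside the cells of a sparse unigraphic partition -/

section CellStructure

open scoped Classical
open Finset

variable {V I : Type*} [Fintype V] {G : SimpleGraph V} {P : V → I}

theorem Unigraphic.cellIso_of_sameDegrees (hG : Unigraphic G P) {H K : SimpleGraph V}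
    (hH : SameDegrees G H P) (hK : SameDegrees G K P) : CellIso H K P :=
  (hG.cellIso H hH).symm.trans (hG.cellIso K hK)

theorem card_cell (P : V → I) (c : I) : Fintype.card {v // P v = c} = cellSize P c :=
  Fintype.card_subtype _

/-- The graph on `V` given by a relation between two cells. -/
def cellGraph {X Y : I} (hXY : X ≠ Y) (T : {v // P v = X} → {v // P v = Y} → Prop) :
    SimpleGraph V where
  Adj u v := (∃ hu hv, T ⟨u, hu⟩ ⟨v, hv⟩) ∨ ∃ hv hu, T ⟨v, hv⟩ ⟨u, hu⟩
  symm := ⟨fun _ _ h => h.symm⟩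
  loopless := ⟨fun _ h => by
    rcases h with ⟨hu, hv, -⟩ | ⟨hu, hv, -⟩ <;> exact hXY (hu.symm.trans hv)⟩

theorem cellGraph_adj {X Y : I} {hXY : X ≠ Y} {T : {v // P v = X} → {v // P v = Y} → Prop}
    (x : {v // P v = X}) (y : {v // P v = Y}) : (cellGraph hXY T).Adj x y ↔ T x y := by
  refine ⟨?_, fun h => Or.inl ⟨x.2, y.2, h⟩⟩
  rintro (⟨_, _, h⟩ | ⟨hy, _, _⟩)
  · exact h
  · exact absurd (hy.symm.trans y.2) hXY

theorem card_filter_cell (P : V → I) (c : I) (p : V → Prop) :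
    #{u | p u ∧ P u = c} = #{y : {v // P v = c} | p y} := by
  symm
  refine card_bij (fun y _ => y.1) ?_ (fun _ _ _ _ h => Subtype.ext h) ?_
  · intro y hy
    simpa [y.2] using hy
  · intro u hu
    simp only [mem_filter, mem_univ, true_and] at hu
    exact ⟨⟨u, hu.2⟩, by simpa using hu.1, rfl⟩

/-- If both degrees were at least 2, sparsity would leave room for two non-isomorphic biregular
graphs between the cells. Pasting each of them into `G` contradicts unigraphicity. -/
theorem Unigraphic.cellDegree_le_one (hG : Unigraphic G P) (hs : Sparse G P) {x y : V}
    (hxy : P x ≠ P y) : cellDegree G P x (P y) ≤ 1 ∨ cellDegree G P y (P x) ≤ 1 := by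
  by_contra! h
  have hx := hs x (P y)
  have hy := hs y (P x)
  rw [cellOthers_of_ne hxy, ← card_cell] at hx
  rw [cellOthers_of_ne hxy.symm, ← card_cell] at hy
  have hc := hG.equitable.double_count x y
  rw [← card_cell, ← card_cell] at hc
  obtain ⟨R, S, hR, hR', hS, hS', hne⟩ := exists_biregular_not_iso h.1 h.2 hy hx hc
  have aux : ∀ T : {v // P v = P x} → {v // P v = P y} → Prop,
      (∀ u, #{v | T u v} = cellDegree G P x (P y)) →
      (∀ v, #{u | T u v} = cellDegree G P y (P x)) →
      SameDegrees G (replaceCells G (cellGraph hxy T) P (P x) (P y)) P := by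
    intro T hT hT'
    refine sameDegrees_replaceCells (fun u hu => ?_) (fun u hu => ?_)
    · rw [hG.equitable u x _ hu, ← hT ⟨u, hu⟩]
      unfold cellDegree
      rw [card_filter_cell]
      simp only [cellGraph_adj (hXY := hxy) ⟨u, hu⟩]
    · rw [hG.equitable u y _ hu, ← hT' ⟨u, hu⟩]
      unfold cellDegree
      rw [card_filter_cell]
      simp only [(cellGraph hxy T).adj_comm u,
        cellGraph_adj (hXY := hxy) (T := T) _ ⟨u, hu⟩]
  obtain ⟨f, hf, hf'⟩ := hG.cellIso_of_sameDegrees (aux R hR hR') (aux S hS hS')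
  refine hne ⟨f.subtypePerm fun v => by rw [hf], f.subtypePerm fun v => by rw [hf], fun u v => ?_⟩
  have := hf' u v
  rw [replaceCells_adj_of_mem u.2 v.2, replaceCells_adj_of_mem (by rw [hf, u.2])
    (by rw [hf, v.2]), cellGraph_adj] at this
  rw [this, ← cellGraph_adj (hXY := hxy) (T := S)]
  rfl

theorem Equitable.even_cellSize_mul (h : Equitable G P) (x : V) :
    Even (cellSize P (P x) * cellDegree G P x (P x)) := by
  have h1 := (G.comap (Subtype.val : {v // P v = P x} → V)).sum_degrees_eq_twice_card_edges
  rw [sum_congr rfl (g := fun _ => cellDegree G P x (P x))] at h1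
  · rw [sum_const, card_univ, card_cell, smul_eq_mul] at h1
    exact h1 ▸ even_two_mul _
  · intro v _
    rw [← h v x _ v.2, cellDegree, card_filter_cell, ← SimpleGraph.card_neighborFinset_eq_degree]
    congr 1
    ext
    simp

/-- The same argument inside one cell, with `exists_regular_not_iso`; the pentagon is the one
exception. -/
theorem Unigraphic.cellDegree_self (hG : Unigraphic G P) (hs : Sparse G P) (x : V) :
    cellDegree G P x (P x) ≤ 1 ∨ (cellSize P (P x) = 5 ∧ cellDegree G P x (P x) = 2) := by
  by_contra! h
  have h1 := hs x (P x)
  have h2 := cellOthers_self_add_one P x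
  have hev := hG.equitable.even_cellSize_mul x
  rw [← card_cell] at h2 hev
  obtain ⟨R, S, hR, hS, hne⟩ := exists_regular_not_iso h.1 (by omega) hev
    (by rw [card_cell]; tauto)
  let ι : {v // P v = P x} ↪ V := Function.Embedding.subtype _
  have hι : ∀ (T : SimpleGraph {v // P v = P x}) (u v : {v // P v = P x}),
      (T.map ι).Adj u v ↔ T.Adj u v :=
    fun T u v => SimpleGraph.map_adj_apply
  have aux : ∀ T : SimpleGraph {v // P v = P x},
      (∀ u, #{v | T.Adj u v} = cellDegree G P x (P x)) →
      SameDegrees G (replaceCells G (T.map ι) P (P x) (P x)) P := by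
    intro T hT
    have : ∀ u, P u = P x → cellDegree (T.map ι) P u (P x) = cellDegree G P u (P x) := by
      intro u hu
      rw [hG.equitable u x _ hu, ← hT ⟨u, hu⟩]
      unfold cellDegree
      rw [card_filter_cell]
      simp only [hι T ⟨u, hu⟩]
    exact sameDegrees_replaceCells this this
  obtain ⟨f, hf, hf'⟩ := hG.cellIso_of_sameDegrees (aux R hR) (aux S hS)
  refine hne ⟨f.subtypePerm fun v => by rw [hf], fun u v => ?_⟩
  have := hf' u v
  rw [replaceCells_adj_of_mem u.2 v.2, replaceCells_adj_of_mem (by rw [hf, u.2])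
    (by rw [hf, v.2]), hι] at this
  rw [this, ← hι]
  rfl

/-- Some edge joins the cells `X` and `Y`. -/
def CellsLinked (G : SimpleGraph V) (P : V → I) (X Y : I) : Prop :=
  ∃ u v, P u = X ∧ P v = Y ∧ G.Adj u v

theorem CellsLinked.symm {X Y : I} (h : CellsLinked G P X Y) : CellsLinked G P Y X := by
  obtain ⟨u, v, hu, hv, huv⟩ := h
  exact ⟨v, u, hv, hu, huv.symm⟩

/-- One of the two positive degrees is 1, and by counting edges it is the degree seen from the
larger cell. -/
theorem CellsLinked.cellDegree_eq_one (hG : Unigraphic G P) (hs : Sparse G P) {X Y : I}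
    (h : CellsLinked G P X Y) (hXY : X ≠ Y) (hle : cellSize P X ≤ cellSize P Y) {y : V}
    (hy : P y = Y) : cellDegree G P y X = 1 := by
  obtain ⟨u, v, rfl, rfl, huv⟩ := h
  rw [hG.equitable _ _ _ hy]
  have h1 := hG.equitable.double_count u v
  have h2 := hG.cellDegree_le_one hs hXY
  have h3 : 0 < cellDegree G P u (P v) := cellDegree_pos.2 ⟨v, huv, rfl⟩
  have h4 : 0 < cellDegree G P v (P u) := cellDegree_pos.2 ⟨u, huv.symm, rfl⟩
  have h5 := cellSize_pos P v
  rcases h2 with h2 | h2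
  · have h2' : cellDegree G P u (P v) = 1 := by omega
    rw [h2', mul_one] at h1
    nlinarith
  · omega

theorem CellsLinked.two_le_cellSize (hG : Unigraphic G P) (hs : Sparse G P) {X Y : I}
    (h : CellsLinked G P X Y) (hXY : X ≠ Y) (hle : cellSize P X ≤ cellSize P Y) :
    2 ≤ cellSize P X := by
  have h' := h
  obtain ⟨u, v, hu, hv, huv⟩ := h
  have h1 := h'.cellDegree_eq_one hG hs hXY hle hv
  have h2 := hs v X
  rw [cellOthers_of_ne (hv ▸ hXY.symm)] at h2
  omega

theorem eq_of_cellDegree_eq_one {v : V} {c : I} (h : cellDegree G P v c = 1) {u w : V}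
    (hu : G.Adj v u) (hu' : P u = c) (hw : G.Adj v w) (hw' : P w = c) : u = w :=
  card_le_one.1 h.le u (by simp [*]) w (by simp [*])

theorem exists_of_cellDegree_eq_one {v : V} {c : I} (h : cellDegree G P v c = 1) :
    ∃ u, G.Adj v u ∧ P u = c := cellDegree_pos.1 (by omega)

/-- The relation induced on a cell `Y` by the edges between `Z` and `Y`: adjacency if `Z = Y`,
having a common neighbor in `Z` otherwise. -/
def cellRel (G : SimpleGraph V) (P : V → I) (Z Y : I) (u v : {v // P v = Y}) : Prop :=
  u ≠ v ∧ if Z = Y then G.Adj u v else ∃ x, P x = Z ∧ G.Adj u x ∧ G.Adj v x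

theorem cellRel_symm {Z Y : I} ⦃u v : {v // P v = Y}⦄ (h : cellRel G P Z Y u v) :
    cellRel G P Z Y v u := by
  refine ⟨h.1.symm, ?_⟩
  have := h.2
  split_ifs at this ⊢
  · exact this.symm
  · obtain ⟨x, h1, h2, h3⟩ := this
    exact ⟨x, h1, h3, h2⟩

/-- Sparsity gives a `q` not adjacent to the end `r` of an edge `p r`. Apart from `p` and `q`
themselves, `p` and `q` have equally many neighbors in the cell, and `r` is one of `p` only, so some
`s` is one of `q` only. -/
theorem hasAlternatingSquare_cellRel_self (hG : Equitable G P) (hs : Sparse G P) {Y : I}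
    (h : CellsLinked G P Y Y) : HasAlternatingSquare (cellRel G P Y Y) := by
  obtain ⟨p, r, rfl, hr, hpr⟩ := h
  have h0 : 0 < cellDegree G P r (P p) := cellDegree_pos.2 ⟨p, hpr.symm, rfl⟩
  obtain ⟨q, hq, hq'⟩ : ∃ q ∈ ({u | u ≠ r ∧ P u = P p} : Finset V),
      q ∉ ({u | G.Adj r u ∧ P u = P p} : Finset V) := by
    refine exists_mem_notMem_of_card_lt_card ?_
    have := hs r (P p)
    unfold cellDegree cellOthers at *
    omega
  simp only [mem_filter, mem_univ, true_and, not_and'] at hq hq'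
  have hqr := hq' hq.2
  have hpq : p ≠ q := by rintro rfl; exact hqr hpr.symm
  obtain ⟨s, hs, hs'⟩ : ∃ s ∈ ({u | G.Adj q u ∧ P u = P p} : Finset V).erase p,
      s ∉ ({u | G.Adj p u ∧ P u = P p} : Finset V).erase q := by
    by_contra! hsub
    have hcard : #(({u | G.Adj p u ∧ P u = P p} : Finset V).erase q) ≤
        #(({u | G.Adj q u ∧ P u = P p} : Finset V).erase p) := by
      rw [card_erase_eq_ite, card_erase_eq_ite]
      have := hG p q (P p) hq.2.symm
      unfold cellDegree at this
      simp only [mem_filter, mem_univ, true_and, hq.2, G.adj_comm q p, and_true, this]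
      rfl
    have heq := eq_of_subset_of_card_le (fun s hs => hsub s hs) hcard
    have : r ∈ ({u | G.Adj p u ∧ P u = P p} : Finset V).erase q := by
      simp [hpr, hr, hq.1.symm]
    rw [← heq] at this
    simp only [mem_erase, mem_filter, mem_univ, true_and] at this
    exact hqr this.2.1.symm
  simp only [mem_erase, mem_filter, mem_univ, true_and, not_and] at hs hs'
  have hsq : s ≠ q := hs.2.1.ne.symm
  have hps : ¬ G.Adj p s := fun h => hs' hsq h hs.2.2
  refine ⟨⟨p, rfl⟩, ⟨q, hq.2⟩, ⟨r, hr⟩, ⟨s, hs.2.2⟩, ?_, ?_, ?_, ?_, ?_, ?_, ?_, ?_⟩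
  · simpa using hpr.ne
  · simpa using hsq.symm
  · simpa using hs.1.symm
  · simpa using hq.1
  · simpa [cellRel] using ⟨hpr.ne, hpr⟩
  · simpa [cellRel] using ⟨hsq.symm, hs.2.1⟩
  · simp [cellRel, hps]
  · simp [cellRel, G.adj_comm q r, hqr]

/-- Each vertex of `Y` has a single neighbor in `Z`, so the relation is that of lying in the same
class of a partition with at least two classes, each of at least two elements. Take `p, r` in one
class and `q, s` in another. -/
theorem hasAlternatingSquare_cellRel_of_lt (hG : Unigraphic G P) (hs : Sparse G P) {Z Y : I}
    (h : CellsLinked G P Z Y) (hlt : cellSize P Z < cellSize P Y) :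
    HasAlternatingSquare (cellRel G P Z Y) := by
  have hZY : Z ≠ Y := by rintro rfl; exact hlt.ne rfl
  have h2 := h.two_le_cellSize hG hs hZY hlt.le
  have h1 := fun y hy => h.cellDegree_eq_one hG hs hZY hlt.le (y := y) hy
  obtain ⟨z, y, rfl, rfl, hzy⟩ := h
  have hdc := hG.equitable.double_count z y
  rw [h1 y rfl, mul_one] at hdc
  have hz : 2 ≤ cellDegree G P z (P y) := by
    by_contra! hz
    have : cellDegree G P z (P y) ≤ 1 := by omega
    nlinarith
  obtain ⟨z', hz', hzz⟩ : ∃ z' ∈ ({u | P u = P z} : Finset V), z' ≠ z :=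
    exists_mem_ne (by unfold cellSize at h2; omega) z
  simp only [mem_filter, mem_univ, true_and] at hz'
  obtain ⟨p, hp, r, hr, hpr⟩ := one_lt_card.1 (show 1 < cellDegree G P z (P y) by omega)
  obtain ⟨q, hq, s, hs, hqs⟩ := one_lt_card.1
    (show 1 < cellDegree G P z' (P y) by rw [hG.equitable z' z _ hz']; omega)
  simp only [mem_filter, mem_univ, true_and] at hp hr hq hs
  have key : ∀ a b, G.Adj z a ∧ P a = P y → G.Adj z' b ∧ P b = P y → a ≠ b ∧
      ∀ x, P x = P z → G.Adj a x → ¬ G.Adj b x := by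
    intro a b ha hb
    refine ⟨?_, fun x hx hax hbx => ?_⟩
    · rintro rfl
      exact hzz (eq_of_cellDegree_eq_one (h1 a ha.2) hb.1.symm hz' ha.1.symm rfl)
    · have e1 := eq_of_cellDegree_eq_one (h1 a ha.2) hax hx ha.1.symm rfl
      have e2 := eq_of_cellDegree_eq_one (h1 b hb.2) hbx hx hb.1.symm hz'
      exact hzz (e2.symm.trans e1)
  obtain ⟨hps, hps'⟩ := key p s hp hs
  obtain ⟨hrq, hrq'⟩ := key r q hr hq
  refine ⟨⟨p, hp.2⟩, ⟨q, hq.2⟩, ⟨r, hr.2⟩, ⟨s, hs.2⟩, ?_, ?_, ?_, ?_, ?_, ?_, ?_, ?_⟩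
  · simpa using hpr
  · simpa using hqs
  · simpa using hps
  · simpa using hrq.symm
  · refine ⟨by simpa using hpr, ?_⟩
    rw [if_neg hZY]
    exact ⟨z, rfl, hp.1.symm, hr.1.symm⟩
  · refine ⟨by simpa using hqs, ?_⟩
    rw [if_neg hZY]
    exact ⟨z', hz', hq.1.symm, hs.1.symm⟩
  · rintro ⟨-, h⟩
    rw [if_neg hZY] at h
    obtain ⟨x, hx, ha, hb⟩ := h
    exact hps' x hx ha hb
  · rintro ⟨-, h⟩
    rw [if_neg hZY] at h
    obtain ⟨x, hx, ha, hb⟩ := h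
    exact hrq' x hx hb ha

end CellStructure

/-! ### Twisting matchings, and invariants read off along walks of matched cells -/

section Reach

open scoped Classical
open Finset

variable {V I : Type*} [Fintype V] {G : SimpleGraph V} {P : V → I}

theorem map_ofSubtype_eq {c : I} (ρ : Equiv.Perm {v // P v = c}) (v : V) :
    P (Equiv.Perm.ofSubtype ρ v) = P v := by
  by_cases h : P v = c
  · rw [Equiv.Perm.ofSubtype_apply_of_mem (p := fun v => P v = c) ρ h, (ρ _).2, h]
  · rw [Equiv.Perm.ofSubtype_apply_of_not_mem (p := fun v => P v = c) ρ h]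

/-- Permute the edges between `Z` and `Y` by a permutation of `Y`. -/
noncomputable def twistCells (G : SimpleGraph V) (P : V → I) (Z : I) {Y : I}
    (ρ : Equiv.Perm {v // P v = Y}) : SimpleGraph V :=
  replaceCells G (G.comap (Equiv.Perm.ofSubtype ρ)) P Z Y

theorem Equitable.sameDegrees_twistCells (hG : Equitable G P) (Z : I) {Y : I}
    (ρ : Equiv.Perm {v // P v = Y}) : SameDegrees G (twistCells G P Z ρ) P := by
  have := hG.sameDegrees_comap (Equiv.Perm.ofSubtype ρ) (map_ofSubtype_eq ρ)
  exact sameDegrees_replaceCells (fun u _ => (this u _).symm) (fun u _ => (this u _).symm)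

theorem twistCells_adj {Z Y : I} (hZY : Z ≠ Y) (ρ : Equiv.Perm {v // P v = Y}) {u : V}
    (hu : P u = Z) (v : {v // P v = Y}) : (twistCells G P Z ρ).Adj u v ↔ G.Adj u (ρ v) := by
  rw [twistCells, replaceCells_adj_of_mem hu v.2, SimpleGraph.comap_adj,
    Equiv.Perm.ofSubtype_apply_coe,
    Equiv.Perm.ofSubtype_apply_of_not_mem (p := fun v => P v = Y) ρ (hu ▸ hZY)]

theorem twistCells_adj_self {Y : I} (ρ : Equiv.Perm {v // P v = Y}) (u v : {v // P v = Y}) :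
    (twistCells G P Y ρ).Adj u v ↔ G.Adj (ρ u) (ρ v) := by
  rw [twistCells, replaceCells_adj_of_mem u.2 v.2, SimpleGraph.comap_adj,
    Equiv.Perm.ofSubtype_apply_coe, Equiv.Perm.ofSubtype_apply_coe]

theorem cellRel_twistCells {Z Y : I} (ρ : Equiv.Perm {v // P v = Y}) (u v : {v // P v = Y}) :
    cellRel (twistCells G P Z ρ) P Z Y u v ↔ cellRel G P Z Y (ρ u) (ρ v) := by
  unfold cellRel
  rw [ρ.injective.ne_iff]
  by_cases hZY : Z = Y
  · subst hZY
    rw [if_pos rfl, if_pos rfl, twistCells_adj_self]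
  · rw [if_neg hZY, if_neg hZY]
    have : ∀ x, P x = Z ∧ (twistCells G P Z ρ).Adj u x ∧ (twistCells G P Z ρ).Adj v x ↔
        P x = Z ∧ G.Adj (ρ u) x ∧ G.Adj (ρ v) x := by
      intro x
      refine and_congr_right fun hx => ?_
      rw [SimpleGraph.adj_comm, twistCells_adj hZY ρ hx, G.adj_comm,
        (twistCells G P Z ρ).adj_comm v, twistCells_adj hZY ρ hx, G.adj_comm x]
    simp only [this]

theorem cellRel_twistCells_of_ne {Z Y Z' Y' : I} (h : s(Z', Y') ≠ s(Z, Y))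
    (ρ : Equiv.Perm {v // P v = Y}) (u v : {v // P v = Y'}) :
    cellRel (twistCells G P Z ρ) P Z' Y' u v ↔ cellRel G P Z' Y' u v := by
  unfold cellRel
  by_cases hZY : Z' = Y'
  · subst hZY
    rw [if_pos rfl, if_pos rfl, twistCells, replaceCells_adj_of_ne (by rwa [u.2, v.2])]
  · rw [if_neg hZY, if_neg hZY]
    have : ∀ x, P x = Z' ∧ (twistCells G P Z ρ).Adj u x ∧ (twistCells G P Z ρ).Adj v x ↔
        P x = Z' ∧ G.Adj u x ∧ G.Adj v x := by
      intro x
      refine and_congr_right fun hx => ?_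
      rw [twistCells, replaceCells_adj_of_ne (by rwa [u.2, hx, Sym2.eq_swap]),
        replaceCells_adj_of_ne (by rwa [v.2, hx, Sym2.eq_swap])]
    simp only [this]

theorem cellRel_map {G H : SimpleGraph V} {f : Equiv.Perm V} (hf : ∀ v, P (f v) = P v)
    (hf' : ∀ u v, G.Adj u v ↔ H.Adj (f u) (f v)) (Z : I) {Y : I} (u v : {v // P v = Y}) :
    cellRel G P Z Y u v ↔
      cellRel H P Z Y ⟨f u, (hf u).trans u.2⟩ ⟨f v, (hf v).trans v.2⟩ := by
  unfold cellRel
  refine and_congr (by simp [Subtype.ext_iff]) ?_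
  split_ifs
  · exact hf' _ _
  · constructor
    · rintro ⟨x, hx, h1, h2⟩
      exact ⟨f x, by rw [hf, hx], (hf' _ _).1 h1, (hf' _ _).1 h2⟩
    · rintro ⟨x, hx, h1, h2⟩
      refine ⟨f.symm x, by rw [← hf, f.apply_symm_apply, hx], (hf' _ _).2 ?_, (hf' _ _).2 ?_⟩ <;>
        simpa

variable {ι : Type*} {K : SimpleGraph ι} {ℓ : ι → I}

/-- There is a path from `u` to `v` through the cells along the given walk. -/
def reach (G : SimpleGraph V) (P : V → I) (ℓ : ι → I) :
    ∀ {i j : ι}, K.Walk i j → V → V → Prop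
  | _, _, .nil, u, v => u = v
  | _, _, .cons (v := k) _ w, u, v => ∃ x, P x = ℓ k ∧ G.Adj u x ∧ reach G P ℓ w x v

theorem reach_map {G H : SimpleGraph V} {f : Equiv.Perm V} (hf : ∀ v, P (f v) = P v)
    (hf' : ∀ u v, G.Adj u v ↔ H.Adj (f u) (f v)) {i j : ι} (w : K.Walk i j) (u v : V) :
    reach G P ℓ w u v ↔ reach H P ℓ w (f u) (f v) := by
  induction w generalizing u with
  | nil => simp [reach]
  | cons h w ih =>
    simp only [reach]
    constructor
    · rintro ⟨x, hx, h1, h2⟩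
      exact ⟨f x, by rw [hf, hx], (hf' _ _).1 h1, (ih _).1 h2⟩
    · rintro ⟨x, hx, h1, h2⟩
      refine ⟨f.symm x, by rw [← hf, f.apply_symm_apply, hx], (hf' _ _).2 ?_, (ih _).2 ?_⟩ <;>
        simpa

theorem reach_replaceCells {R : SimpleGraph V} {X Y : I} {i j : ι} (w : K.Walk i j)
    (hw : ∀ k l, s(k, l) ∈ w.edges → s(ℓ k, ℓ l) ≠ s(X, Y)) {u : V} (hu : P u = ℓ i) (v : V) :
    reach (replaceCells G R P X Y) P ℓ w u v ↔ reach G P ℓ w u v := by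
  induction w generalizing u with
  | nil => simp [reach]
  | cons h w ih =>
    simp only [reach]
    refine exists_congr fun x => and_congr_right fun hx => and_congr ?_ ?_
    · rw [replaceCells_adj_of_ne]
      rw [hu, hx]
      exact hw _ _ (by simp)
    · exact ih (fun k l hkl => hw k l (by simp [hkl])) hx

theorem exists_matching_equiv {X Y : I} (hX : ∀ x, P x = X → cellDegree G P x Y = 1)
    (hY : ∀ y, P y = Y → cellDegree G P y X = 1) :
    ∃ e : {v // P v = X} ≃ {v // P v = Y},
      ∀ (u : {v // P v = X}) (v : {v // P v = Y}), G.Adj u v ↔ e u = v := by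
  choose f hf hf' using fun x : {v // P v = X} => exists_of_cellDegree_eq_one (hX x x.2)
  choose g hg hg' using fun x : {v // P v = Y} => exists_of_cellDegree_eq_one (hY x x.2)
  refine ⟨⟨fun x => ⟨f x, hf' x⟩, fun y => ⟨g y, hg' y⟩, fun x => ?_, fun y => ?_⟩, fun u v => ?_⟩
  · exact Subtype.ext
      (eq_of_cellDegree_eq_one (hY _ (hf' x)) (hg ⟨f x, hf' x⟩) (hg' _) (hf x).symm x.2)
  · exact Subtype.ext
      (eq_of_cellDegree_eq_one (hX _ (hg' y)) (hf ⟨g y, hg' y⟩) (hf' _) (hg y).symm y.2)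
  · constructor
    · intro h
      exact Subtype.ext (eq_of_cellDegree_eq_one (hX _ u.2) (hf u) (hf' u) h v.2)
    · rintro rfl
      exact hf u

theorem exists_reach_equiv
    (hK : ∀ i j, K.Adj i j → ∀ v, P v = ℓ i → cellDegree G P v (ℓ j) = 1) {i j : ι}
    (w : K.Walk i j) :
    ∃ e : {v // P v = ℓ i} ≃ {v // P v = ℓ j},
      ∀ (u : {v // P v = ℓ i}) (v : {v // P v = ℓ j}), reach G P ℓ w u v ↔ e u = v := by
  induction w with
  | nil => exact ⟨Equiv.refl _, fun u v => by simp [reach, Subtype.ext_iff]⟩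
  | cons h w ih =>
    obtain ⟨e, he⟩ := ih
    obtain ⟨e₀, he₀⟩ := exists_matching_equiv (hK _ _ h) (hK _ _ h.symm)
    refine ⟨e₀.trans e, fun u v => ?_⟩
    simp only [reach, Equiv.trans_apply]
    constructor
    · rintro ⟨x, hx, h1, h2⟩
      rw [(he₀ u ⟨x, hx⟩).1 h1]
      exact (he ⟨x, hx⟩ v).1 h2
    · intro h
      exact ⟨e₀ u, (e₀ u).2, (he₀ _ _).2 rfl, (he _ _).2 h⟩

/-- The cells of the same size that are matched to each other do not form a cycle. -/
theorem Unigraphic.false_of_closed_walk (hG : Unigraphic G P) (hℓ : Function.Injective ℓ)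
    (hK : ∀ i j, K.Adj i j → ∀ v, P v = ℓ i → cellDegree G P v (ℓ j) = 1) {i j : ι}
    (hij : K.Adj i j) (w : K.Walk j i) (hw : s(i, j) ∉ w.edges) (h2 : 2 ≤ cellSize P (ℓ j)) :
    False := by
  obtain ⟨m, hm⟩ := exists_matching_equiv (hK _ _ hij) (hK _ _ hij.symm)
  obtain ⟨e, he⟩ := exists_reach_equiv hK w
  have hne : ℓ i ≠ ℓ j := fun h => hij.ne (hℓ h)
  -- The number of vertices that return to themselves around the cycle is an isomorphism invariant.
  -- After twisting by `ρ` it counts the points where `ρ` agrees with the fixed map `m ∘ e`.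
  have key : ∀ ρ : Equiv.Perm {v // P v = ℓ j},
      #{u : {v // P v = ℓ i} | ∃ v : {v // P v = ℓ j},
        (twistCells G P (ℓ i) ρ).Adj u v ∧ reach (twistCells G P (ℓ i) ρ) P ℓ w v u} =
      #{v : {v // P v = ℓ j} | m (e v) = ρ v} := by
    intro ρ
    symm
    refine card_bij (fun v _ => e v) ?_ (fun _ _ _ _ h => e.injective h) ?_
    · intro v hv
      simp only [mem_filter, mem_univ, true_and] at hv ⊢
      refine ⟨v, ?_, ?_⟩
      · rw [twistCells_adj hne ρ (e v).2, hm, hv]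
      · rw [twistCells, reach_replaceCells w ?_ v.2, he]
        intro k l hkl heq
        rw [← Sym2.map_mk, ← Sym2.map_mk, (Sym2.map.injective hℓ).eq_iff] at heq
        exact hw (heq ▸ hkl)
    · intro u hu
      simp only [mem_filter, mem_univ, true_and] at hu ⊢
      obtain ⟨v, h1, h2⟩ := hu
      rw [twistCells_adj hne ρ u.2, hm] at h1
      rw [twistCells, reach_replaceCells w ?_ v.2, he] at h2
      · exact ⟨v, by rw [h2, h1], h2⟩
      · intro k l hkl heq
        rw [← Sym2.map_mk, ← Sym2.map_mk, (Sym2.map.injective hℓ).eq_iff] at heq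
        exact hw (heq ▸ hkl)
  have hinv : ∀ ρ τ : Equiv.Perm {v // P v = ℓ j},
      #{v : {v // P v = ℓ j} | m (e v) = ρ v} = #{v : {v // P v = ℓ j} | m (e v) = τ v} := by
    intro ρ τ
    rw [← key, ← key]
    obtain ⟨f, hf, hf'⟩ := hG.cellIso_of_sameDegrees
      (hG.equitable.sameDegrees_twistCells (ℓ i) ρ) (hG.equitable.sameDegrees_twistCells (ℓ i) τ)
    refine card_filter_perm _ _ (f.subtypePerm fun v => by rw [hf]) fun u => ?_
    constructor
    · rintro ⟨v, h1, h2⟩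
      exact ⟨f.subtypePerm (fun v => by rw [hf]) v, (hf' _ _).1 h1, (reach_map hf hf' w _ _).1 h2⟩
    · rintro ⟨v, h1, h2⟩
      obtain ⟨v, rfl⟩ :=
        (f.subtypePerm (p := fun v => P v = ℓ j) (fun v => by rw [hf])).surjective v
      exact ⟨v, (hf' _ _).2 h1, (reach_map hf hf' w _ _).2 h2⟩
  obtain ⟨a, b, hab⟩ := Fintype.one_lt_card_iff.1
    (show 1 < Fintype.card {v // P v = ℓ j} by rw [card_cell]; omega)
  -- The first permutation agrees with `m ∘ e` everywhere, the second fails to at `a`.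
  have h := hinv (e.trans m) ((Equiv.swap a b).trans (e.trans m))
  have h1 : #{v : {v // P v = ℓ j} | m (e v) = (e.trans m) v} = #(univ : Finset {v // P v = ℓ j}) := by
    congr 1; ext; simp
  rw [h1] at h
  have := (eq_of_subset_of_card_le (filter_subset _ _) h.le) ▸ mem_univ a
  simp [hab] at this

/-- Two different cells cannot both induce a nontrivial relation on the same cell, nor on cells
matched to each other. -/
theorem Unigraphic.false_of_two_cellRel (hG : Unigraphic G P) (hs : Sparse G P)
    (hℓ : Function.Injective ℓ) {n : ℕ} (hn : ∀ i, cellSize P (ℓ i) = n)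
    (hK : ∀ i j, K.Adj i j → ∀ v, P v = ℓ i → cellDegree G P v (ℓ j) = 1) {i j : ι}
    (w : K.Walk i j) {Z Z' : I} (hZ : CellsLinked G P Z (ℓ i)) (hZ' : CellsLinked G P Z' (ℓ j))
    (hZn : Z = ℓ i ∨ cellSize P Z < n) (hZn' : Z' = ℓ j ∨ cellSize P Z' < n)
    (hne : i = j → Z ≠ Z') : False := by
  have hsq : ∀ {k Z}, CellsLinked G P Z (ℓ k) → (Z = ℓ k ∨ cellSize P Z < n) →
      HasAlternatingSquare (cellRel G P Z (ℓ k)) := by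
    rintro k Z h (rfl | hlt)
    · exact hasAlternatingSquare_cellRel_self hG.equitable hs h
    · exact hasAlternatingSquare_cellRel_of_lt hG hs h (by rwa [hn])
  obtain ⟨e, he⟩ := exists_reach_equiv hK w
  -- Both relations, compared along the walk, live on one set, and `σ`, `τ` superpose them with
  -- different numbers of common pairs.
  obtain ⟨σ, τ, hστ⟩ := (hsq hZ hZn).exists_equiv_card_ne cellRel_symm cellRel_symm (hsq hZ' hZn') e
  have hpair : s(Z, ℓ i) ≠ s(Z', ℓ j) := by
    intro h
    rw [Sym2.eq_iff] at h
    rcases h with ⟨h1, h2⟩ | ⟨h1, h2⟩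
    · exact hne (hℓ h2) h1
    · rcases hZn with h3 | h3
      · exact hne (hℓ (h3.symm.trans h1)) (h3.trans h2)
      · rw [h1, hn] at h3
        exact h3.false
  have hwe : ∀ k l, s(k, l) ∈ w.edges → s(ℓ k, ℓ l) ≠ s(Z', ℓ j) := by
    intro k l hkl h
    have hadj := w.adj_of_mem_edges hkl
    rw [Sym2.eq_iff] at h
    rcases h with ⟨h1, h2⟩ | ⟨h1, h2⟩ <;> rcases hZn' with h3 | h3
    · exact hadj.ne (hℓ (h1.trans (h3.trans h2.symm)))
    · rw [← h1, hn] at h3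
      exact h3.false
    · exact hadj.ne (hℓ (h1.trans (h2.trans h3).symm))
    · rw [← h2, hn] at h3
      exact h3.false
  -- Twisting by `σ ∘ e⁻¹` affects neither the relation of `Z` nor the walk, and transport along the
  -- walk by `e` turns the twist into `σ`. The left side is invariant under isomorphisms preserving
  -- cells, so twists for `σ` and for `τ` are not isomorphic.
  have key : ∀ σ : {v // P v = ℓ i} ≃ {v // P v = ℓ j},
      #{z : {v // P v = ℓ i} × {v // P v = ℓ i} |
        cellRel (twistCells G P Z' (e.symm.trans σ)) P Z (ℓ i) z.1 z.2 ∧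
        ∃ x y : {v // P v = ℓ j}, reach (twistCells G P Z' (e.symm.trans σ)) P ℓ w z.1 x ∧
          reach (twistCells G P Z' (e.symm.trans σ)) P ℓ w z.2 y ∧
          cellRel (twistCells G P Z' (e.symm.trans σ)) P Z' (ℓ j) x y} =
      #{z : {v // P v = ℓ i} × {v // P v = ℓ i} | cellRel G P Z (ℓ i) z.1 z.2 ∧
        cellRel G P Z' (ℓ j) (σ z.1) (σ z.2)} := by
    intro σ
    congr 1
    ext z
    simp only [mem_filter, mem_univ, true_and]
    rw [cellRel_twistCells_of_ne hpair]
    refine and_congr_right fun _ => ?_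
    simp only [cellRel_twistCells]
    have hr : ∀ (u : {v // P v = ℓ i}) (v : {v // P v = ℓ j}),
        reach (twistCells G P Z' (e.symm.trans σ)) P ℓ w u v ↔ e u = v := fun u v => by
      rw [twistCells, reach_replaceCells w hwe u.2, he]
    simp [hr]
  have hinv : ∀ ρ τ : Equiv.Perm {v // P v = ℓ j}, _ = _ := fun ρ τ => by
    obtain ⟨f, hf, hf'⟩ := hG.cellIso_of_sameDegrees
      (hG.equitable.sameDegrees_twistCells Z' ρ) (hG.equitable.sameDegrees_twistCells Z' τ)
    refine card_filter_perm
      (fun z : {v // P v = ℓ i} × {v // P v = ℓ i} =>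
        cellRel (twistCells G P Z' ρ) P Z (ℓ i) z.1 z.2 ∧
        ∃ x y : {v // P v = ℓ j}, reach (twistCells G P Z' ρ) P ℓ w z.1 x ∧
          reach (twistCells G P Z' ρ) P ℓ w z.2 y ∧
          cellRel (twistCells G P Z' ρ) P Z' (ℓ j) x y)
      (fun z : {v // P v = ℓ i} × {v // P v = ℓ i} =>
        cellRel (twistCells G P Z' τ) P Z (ℓ i) z.1 z.2 ∧
        ∃ x y : {v // P v = ℓ j}, reach (twistCells G P Z' τ) P ℓ w z.1 x ∧
          reach (twistCells G P Z' τ) P ℓ w z.2 y ∧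
          cellRel (twistCells G P Z' τ) P Z' (ℓ j) x y)
      ((f.subtypePerm fun v => by rw [hf]).prodCongr (f.subtypePerm fun v => by rw [hf]))
      fun z => ?_
    refine and_congr (cellRel_map hf hf' Z _ _) ?_
    let g := f.subtypePerm (p := fun v => P v = ℓ j) (fun v => by rw [hf])
    constructor
    · rintro ⟨x, y, h1, h2, h3⟩
      exact ⟨g x, g y, (reach_map hf hf' w _ _).1 h1, (reach_map hf hf' w _ _).1 h2,
        (cellRel_map hf hf' Z' _ _).1 h3⟩
    · rintro ⟨x, y, h1, h2, h3⟩
      obtain ⟨x, rfl⟩ := g.surjective x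
      obtain ⟨y, rfl⟩ := g.surjective y
      exact ⟨x, y, (reach_map hf hf' w _ _).2 h1, (reach_map hf hf' w _ _).2 h2,
        (cellRel_map hf hf' Z' _ _).2 h3⟩
  refine hστ ?_
  rw [← key, ← key]
  exact hinv _ _

end Reach

/-! ### Existence of an isolated or pendant cell -/

section Removable

open scoped Classical
open Finset

variable {V I : Type*} [Fintype V] {G : SimpleGraph V} {P : V → I}

/-- Within the set of cells `S`, the cell `Y` is isolated, or it is edgeless and hangs at a single
other cell. -/
def RemovableCell (G : SimpleGraph V) (P : V → I) (S : Finset I) (Y : I) : Prop :=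
  (∀ Z ∈ S, Z ≠ Y → ¬ CellsLinked G P Z Y) ∨
  (¬ CellsLinked G P Y Y ∧ ∃ X ∈ S, X ≠ Y ∧ (∀ y, P y = Y → cellDegree G P y X = 1) ∧
    ∀ Z ∈ S, Z ≠ Y → Z ≠ X → ¬ CellsLinked G P Z Y)

/-- Look at the largest cells of `S`. If none were removable, each would have two links. The
matchings among them form a forest, so each end of a longest path has a link that is not a matching
of the forest. The resulting two relations contradict `Unigraphic.false_of_two_cellRel`. -/
theorem Unigraphic.exists_removableCell (hG : Unigraphic G P) (hs : Sparse G P) {S : Finset I}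
    (hS : S.Nonempty) : ∃ Y ∈ S, RemovableCell G P S Y := by
  by_contra! hnone
  obtain ⟨Y₀, hY₀, hmax⟩ := exists_max_image S (cellSize P) hS
  set n := cellSize P Y₀ with hn
  let ι := {Y : I // Y ∈ S ∧ cellSize P Y = n}
  let ℓ : ι → I := Subtype.val
  have hℓ : Function.Injective ℓ := Subtype.val_injective
  have hℓn : ∀ i, cellSize P (ℓ i) = n := fun i => i.2.2
  let K : SimpleGraph ι :=
    { Adj := fun i j => i ≠ j ∧ CellsLinked G P (ℓ i) (ℓ j)
      symm := ⟨fun _ _ h => ⟨h.1.symm, h.2.symm⟩⟩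
      loopless := ⟨fun _ h => h.1 rfl⟩ }
  have hK : ∀ i j, K.Adj i j → ∀ v, P v = ℓ i → cellDegree G P v (ℓ j) = 1 := fun i j hij v hv =>
    hij.2.symm.cellDegree_eq_one hG hs (hℓ.ne hij.1.symm) (by rw [hℓn, hℓn]) hv
  have hacyc : K.IsAcyclic := by
    rw [SimpleGraph.isAcyclic_iff_forall_adj_isBridge]
    intro i j hij
    rw [SimpleGraph.isBridge_iff_forall_walk_mem_edges]
    intro w
    by_contra hw
    refine hG.false_of_closed_walk hℓ hK hij w.reverse (by simpa using hw) ?_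
    exact hij.2.symm.two_le_cellSize hG hs (hℓ.ne hij.1.symm) (by rw [hℓn, hℓn])
  -- every cell has two links, counting a link to itself
  have htwo : ∀ i : ι, ∃ Z ∈ S, ∃ Z' ∈ S, Z ≠ Z' ∧ CellsLinked G P Z (ℓ i) ∧
      CellsLinked G P Z' (ℓ i) := by
    intro i
    have h := hnone (ℓ i) i.2.1
    simp only [RemovableCell, not_or, not_forall, not_not] at h
    obtain ⟨⟨X, hX, hXi, hlink⟩, h2⟩ := h
    -- A single link, to another cell, would make the cell pendant: degree 1 towards that cell is
    -- automatic because no cell of `S` is larger.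
    by_contra! hc
    refine h2 ⟨fun h => hc X hX (ℓ i) i.2.1 hXi hlink h, X, hX, hXi, fun y hy => ?_, ?_⟩
    · exact hlink.cellDegree_eq_one hG hs hXi (by rw [hℓn]; exact hmax X hX) hy
    · exact fun Z hZ _ hZX h => hc Z hZ X hX hZX h hlink
  have hkind : ∀ (i : ι) (Z : I), Z ∈ S → CellsLinked G P Z (ℓ i) →
      (Z = ℓ i ∨ cellSize P Z < n) ∨ ∃ j, ℓ j = Z ∧ K.Adj i j := by
    intro i Z hZ hlink
    by_cases h : Z = ℓ i
    · exact Or.inl (Or.inl h)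
    · rcases (hmax Z hZ).lt_or_eq with hlt | heq
      · exact Or.inl (Or.inr hlt)
      · exact Or.inr ⟨⟨Z, hZ, heq⟩, rfl, fun h' => h (by rw [h']), hlink.symm⟩
  have : Nonempty ι := ⟨⟨Y₀, hY₀, rfl⟩⟩
  have : Finite ι := Finite.of_injective (fun i : ι => (⟨i.1, i.2.1⟩ : S))
    fun i j h => hℓ (Subtype.mk.inj h)
  obtain ⟨u, v, p, hp, hlen⟩ := SimpleGraph.Walk.exists_isPath_forall_isPath_length_le_length K
  have hmem : ∀ {u v : ι} {p : K.Walk u v}, p.IsPath →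
      (∀ (u' v' : ι) (p' : K.Walk u' v'), p'.IsPath → p'.length ≤ p.length) →
      ∀ w, K.Adj u w → w ∈ p.support := by
    intro u v p hp hlen w huw
    by_contra hw
    have := hlen _ _ (.cons huw.symm p) (hp.cons hw)
    simp at this
  have hend : ∀ {u v : ι} {p : K.Walk u v}, p.IsPath →
      (∀ (u' v' : ι) (p' : K.Walk u' v'), p'.IsPath → p'.length ≤ p.length) →
      ∃ Z, CellsLinked G P Z (ℓ u) ∧ (Z = ℓ u ∨ cellSize P Z < n) := by
    intro u v p hp hlen
    obtain ⟨Z, hZ, Z', hZ', hne, hl, hl'⟩ := htwo u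
    rcases hkind u Z hZ hl with h | ⟨j, rfl, hj⟩
    · exact ⟨Z, hl, h⟩
    rcases hkind u Z' hZ' hl' with h | ⟨j', rfl, hj'⟩
    · exact ⟨Z', hl', h⟩
    -- By maximality every neighbor of the end lies on the path, and in a forest it must then be the
    -- second vertex. So at most one link is a matching.
    have h1 := hacyc.eq_snd_of_adj_start hp hj (hmem hp hlen j hj)
    have h2 := hacyc.eq_snd_of_adj_start hp hj' (hmem hp hlen j' hj')
    exact absurd (by rw [h1, h2]) hne
  -- A path without edges means there are no matchings at `u`; then both links of `u` itself are
  -- used, with the trivial walk.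
  by_cases huv : u = v
  · subst huv
    have hnil : p = .nil := SimpleGraph.Walk.eq_nil_iff_nil.2 (SimpleGraph.Walk.isPath_iff_nil.1 hp)
    have hno : ∀ j, ¬ K.Adj u j := by
      intro j hj
      have := hmem hp (fun _ _ _ h => hlen _ _ _ h) j hj
      rw [hnil, SimpleGraph.Walk.support_nil, List.mem_singleton] at this
      exact hj.ne this.symm
    obtain ⟨Z, hZ, Z', hZ', hne, hl, hl'⟩ := htwo u
    rcases hkind u Z hZ hl with h | ⟨j, -, hj⟩
    · rcases hkind u Z' hZ' hl' with h' | ⟨j, -, hj⟩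
      · exact hG.false_of_two_cellRel hs hℓ hℓn hK (.nil : K.Walk u u) hl hl' h h' fun _ => hne
      · exact hno j hj
    · exact hno j hj
  · obtain ⟨Z, hl, h⟩ := hend hp fun _ _ _ h => hlen _ _ _ h
    obtain ⟨Z', hl', h'⟩ := hend hp.reverse fun _ _ _ h => by
      rw [SimpleGraph.Walk.length_reverse]
      exact hlen _ _ _ h
    exact hG.false_of_two_cellRel hs hℓ hℓn hK p hl hl' h h' fun h => absurd h huv

end Removable

/-! ### Building the isomorphism for an equitable refinement -/

section Refinement

open scoped Classical
open Finset

variable {V I J : Type*} [Fintype V] {G H : SimpleGraph V} {P : V → I} {Q : V → J}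

theorem SameDegrees.cellsLinked (h : SameDegrees G H P) {X Y : I} (hXY : CellsLinked H P X Y) :
    CellsLinked G P X Y := by
  obtain ⟨u, v, hu, hv, huv⟩ := hXY
  have : 0 < cellDegree G P u Y := by rw [h]; exact cellDegree_pos.2 ⟨v, huv, hv⟩
  obtain ⟨w, hw, hw'⟩ := cellDegree_pos.1 this
  exact ⟨u, w, hu, hw', hw⟩

theorem SameDegrees.exists_adj (h : SameDegrees G H Q) {u v : V} (huv : G.Adj u v) :
    ∃ w, H.Adj u w ∧ Q w = Q v :=
  cellDegree_pos.1 (by rw [← h]; exact cellDegree_pos.2 ⟨v, huv, rfl⟩)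

theorem exists_perm_ite {f g : Equiv.Perm V} (hf : ∀ v, P (f v) = P v) (hg : ∀ v, P (g v) = P v)
    (Y : I) : ∃ h : Equiv.Perm V, ∀ v, h v = if P v = Y then g v else f v := by
  have hinj : Function.Injective fun v => if P v = Y then g v else f v := by
    intro u v huv
    have hP : P u = P v := by
      have := congrArg P huv
      simp only [apply_ite P, hf, hg, ite_self] at this
      exact this
    simp only [hP] at huv
    split_ifs at huv
    · exact g.injective huv
    · exact f.injective huv
  exact ⟨Equiv.ofBijective _ hinj.bijective_of_finite, fun v => rfl⟩

theorem exists_equiv_of_card_fiber {α β γ : Type*} [Fintype α] [Fintype β] [DecidableEq γ]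
    (φ : α → γ) (ψ : β → γ)
    (h : ∀ c, #{a | φ a = c} = #{a | ψ a = c}) : ∃ e : α ≃ β, ∀ a, ψ (e a) = φ a := by
  have : ∀ c, Nonempty ({a // φ a = c} ≃ {b // ψ b = c}) := fun c =>
    ⟨Fintype.equivOfCardEq (by rw [Fintype.card_subtype, Fintype.card_subtype, h])⟩
  exact ⟨Equiv.ofFiberEquiv fun c => (this c).some, fun a => Equiv.ofFiberEquiv_map _ a⟩

/-- Let `σ` give the partner in `G`. If `H` matches `y` to `w` instead of `σ y`, the partner can be
chosen in the same `Q`-class, and exchanging `w` and `σ y` in `H` repairs `y`. Induct on the number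
of wrong vertices. -/
theorem exists_perm_of_matching (hQ : ∀ u v, Q u = Q v → P u = P v) (hG : Equitable G Q)
    {Y : I} (h1 : ∀ y, P y = Y → cellDegree G P y Y = 1) {H : SimpleGraph V}
    (h : SameDegrees G H Q) : ∃ g : Equiv.Perm V, (∀ v, Q (g v) = Q v) ∧
      ∀ u v, P u = Y → P v = Y → (G.Adj u v ↔ H.Adj (g u) (g v)) := by
  choose! σ hσ hσ' using fun y (hy : P y = Y) => exists_of_cellDegree_eq_one (h1 y hy)
  induction hm : #{y | P y = Y ∧ ¬ H.Adj y (σ y)} using Nat.strong_induction_on generalizing H with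
  | _ m ih =>
    have h1' : ∀ y, P y = Y → cellDegree H P y Y = 1 := fun y hy => by
      rw [← h.coarsen hQ, h1 y hy]
    by_cases hall : ∀ y, P y = Y → H.Adj y (σ y)
    · refine ⟨1, fun _ => rfl, fun u v hu hv => ?_⟩
      simp only [Equiv.Perm.one_apply]
      constructor <;> intro huv
      · rw [eq_of_cellDegree_eq_one (h1 u hu) huv hv (hσ u hu) (hσ' u hu)]
        exact hall u hu
      · rw [eq_of_cellDegree_eq_one (h1' u hu) huv hv (hall u hu) (hσ' u hu)]
        exact hσ u hu
    · push Not at hall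
      obtain ⟨y, hy, hyσ⟩ := hall
      obtain ⟨w, hyw, hwQ⟩ := h.exists_adj (hσ y hy)
      have hwY : P w = Y := (hQ _ _ hwQ).trans (hσ' y hy)
      have hwσ : w ≠ σ y := by rintro rfl; exact hyσ hyw
      have hs : ∀ v, Q (Equiv.swap (σ y) w v) = Q v := fun v => by
        rw [Equiv.swap_apply_def]
        split_ifs with h1 h2
        · rw [h1, hwQ]
        · rw [h2, hwQ]
        · rfl
      have hH' := h.trans ((h.equitable hG).sameDegrees_comap _ hs)
      have hsy : Equiv.swap (σ y) w y = y :=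
        Equiv.swap_apply_of_ne_of_ne (hσ y hy).ne hyw.ne
      -- No correctly matched pair contains `σ y` or `w`, so the exchange spoils nothing.
      have hlt : #{z | P z = Y ∧ ¬ (H.comap (Equiv.swap (σ y) w)).Adj z (σ z)} < m := by
        rw [← hm]
        refine card_lt_card ((ssubset_iff_of_subset ?_).2 ⟨y, by simp [hy, hyσ], ?_⟩)
        · intro z hz
          simp only [mem_filter, mem_univ, true_and, SimpleGraph.comap_adj] at hz ⊢
          refine ⟨hz.1, fun hzσ => hz.2 ?_⟩
          have hzy : z ≠ y := by rintro rfl; exact hyσ hzσ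
          have e1 : σ z ≠ σ y := fun e => hzy <| eq_of_cellDegree_eq_one (h1 _ (hσ' y hy))
            (e ▸ (hσ z hz.1).symm) hz.1 (hσ y hy).symm hy
          have e2 : σ z ≠ w := fun e => hzy <| eq_of_cellDegree_eq_one (h1' w hwY)
            (e ▸ hzσ.symm) hz.1 hyw.symm hy
          have e3 : z ≠ σ y := by
            rintro rfl
            have := eq_of_cellDegree_eq_one (h1 _ hz.1) (hσ _ hz.1) (hσ' _ hz.1) (hσ y hy).symm hy
            rw [this] at hzσ
            exact hyσ hzσ.symm
          have e4 : z ≠ w := by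
            rintro rfl
            have := eq_of_cellDegree_eq_one (h1' _ hz.1) hzσ (hσ' _ hz.1) hyw.symm hy
            have h3 := hσ _ hz.1
            rw [this] at h3
            exact hwσ (eq_of_cellDegree_eq_one (h1 y hy) h3.symm hz.1 (hσ y hy) (hσ' y hy))
          rwa [Equiv.swap_apply_of_ne_of_ne e3 e4, Equiv.swap_apply_of_ne_of_ne e1 e2]
        · simp [hy, hsy, hyw]
      obtain ⟨g, hg, hg'⟩ := ih _ hlt hH' rfl
      refine ⟨g.trans (Equiv.swap (σ y) w), fun v => ?_, fun u v hu hv => ?_⟩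
      · rw [Equiv.trans_apply, hs, hg]
      · rw [hg' u v hu hv]
        rfl

/-- A 5-cycle pasted into the cell has the same degrees, so unigraphicity identifies the inner graph
with it without classifying 2-regular graphs. -/
theorem Unigraphic.exists_pentagon (hG : Unigraphic G P) {Y : I} (h5 : cellSize P Y = 5)
    (h2 : ∀ y, P y = Y → cellDegree G P y Y = 2) :
    ∃ c : Fin 5 ≃ {v // P v = Y}, ∀ i j, G.Adj (c i) (c j) ↔ (SimpleGraph.cycleGraph 5).Adj i j := by
  let e : Fin 5 ≃ {v // P v = Y} := Fintype.equivOfCardEq (by rw [card_cell, h5]; simp)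
  let R : SimpleGraph V :=
    (SimpleGraph.cycleGraph 5).map (e.toEmbedding.trans (Function.Embedding.subtype _))
  have hR : ∀ i j, R.Adj (e i) (e j) ↔ (SimpleGraph.cycleGraph 5).Adj i j := fun i j =>
    SimpleGraph.map_adj_apply
  have hdeg : ∀ y, P y = Y → cellDegree R P y Y = cellDegree G P y Y := by
    intro y hy
    rw [h2 y hy, ← SimpleGraph.cycleGraph_degree_three_le (n := 2) (v := e.symm ⟨y, hy⟩)]
    unfold cellDegree
    rw [card_filter_cell, ← SimpleGraph.card_neighborFinset_eq_degree]
    symm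
    refine card_bij (fun i _ => e i) ?_ (fun _ _ _ _ h => e.injective h) ?_
    · intro i hi
      simp only [SimpleGraph.mem_neighborFinset, mem_filter, mem_univ, true_and] at hi ⊢
      rw [← hR] at hi
      simpa using hi
    · intro v hv
      simp only [SimpleGraph.mem_neighborFinset, mem_filter, mem_univ, true_and] at hv ⊢
      refine ⟨e.symm v, ?_, by simp⟩
      rw [← hR]
      simpa using hv
  obtain ⟨f, hf, hf'⟩ := hG.cellIso_of_sameDegrees (sameDegrees_replaceCells hdeg hdeg)
    (fun _ _ => rfl)
  refine ⟨e.trans (f.subtypePerm fun v => by rw [hf]), fun i j => ?_⟩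
  have := hf' (e i) (e j)
  rw [replaceCells_adj_of_mem (e i).2 (e j).2, hR] at this
  exact this.symm

/-- The color of a vertex determines the colors of its two neighbors as an unordered pair. Once one
vertex and one direction are aligned, the remaining colors are forced around the cycle; the two
directions give a rotation and a reflection. -/
theorem exists_dihedral (q q' : Fin 5 → J) (h0 : ∃ k, q 0 = q' k)
    (hN : ∀ i k, q i = q' k → s(q (i + 1), q (i - 1)) = s(q' (k + 1), q' (k - 1))) :
    ∃ d : Equiv.Perm (Fin 5), (∀ i, q' (d i) = q i) ∧
      ∀ i j, (SimpleGraph.cycleGraph 5).Adj i j ↔ (SimpleGraph.cycleGraph 5).Adj (d i) (d j) := by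
  have hN' : ∀ i k, q i = q' k → q (i + 1) = q' (k + 1) → q (i + 1 + 1) = q' (k + 1 + 1) := by
    intro i k h1 h2
    have := hN _ _ h2
    rw [add_sub_cancel_right, add_sub_cancel_right, h1, Sym2.congr_left] at this
    exact this
  have hN'' : ∀ i k, q i = q' k → q (i + 1) = q' (k - 1) → q (i + 1 + 1) = q' (k - 1 - 1) := by
    intro i k h1 h2
    have := hN _ _ h2
    rw [add_sub_cancel_right, sub_add_cancel, h1, Sym2.eq_swap, Sym2.congr_right] at this
    exact this
  have hadd : ∀ k i j : Fin 5, (SimpleGraph.cycleGraph 5).Adj i j ↔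
      (SimpleGraph.cycleGraph 5).Adj (k + i) (k + j) := by decide
  have hsub : ∀ k i j : Fin 5, (SimpleGraph.cycleGraph 5).Adj i j ↔
      (SimpleGraph.cycleGraph 5).Adj (k - i) (k - j) := by decide
  obtain ⟨k, hk⟩ := h0
  have h := hN 0 k hk
  rw [Sym2.eq_iff] at h
  rcases h with ⟨h1, -⟩ | ⟨h1, -⟩
  · have h2 := hN' _ _ hk h1
    have h3 := hN' _ _ h1 h2
    have h4 := hN' _ _ h2 h3
    refine ⟨Equiv.addLeft k, fun i => ?_, fun i j => ?_⟩
    · simp only [Equiv.coe_addLeft]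
      fin_cases i
      · simpa using hk.symm
      · exact h1.symm
      · simpa [add_assoc] using h2.symm
      · simpa [add_assoc] using h3.symm
      · simpa [add_assoc] using h4.symm
    · exact hadd k i j
  · have h2 := hN'' _ _ hk h1
    have h3 := hN'' _ _ h1 h2
    have h4 := hN'' _ _ h2 h3
    refine ⟨Equiv.subLeft k, fun i => ?_, fun i j => ?_⟩
    · simp only [Equiv.subLeft_apply]
      fin_cases i
      · simpa using hk.symm
      · exact h1.symm
      · simpa [sub_sub] using h2.symm
      · simpa [sub_sub] using h3.symm
      · simpa [sub_sub] using h4.symm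
    · exact hsub k i j

theorem Unigraphic.exists_perm_of_pentagon (hG : Unigraphic G P)
    (hQ : ∀ u v, Q u = Q v → P u = P v) (hGQ : Equitable G Q) (h : SameDegrees G H Q) {Y : I}
    (h5 : cellSize P Y = 5) (h2 : ∀ y, P y = Y → cellDegree G P y Y = 2) :
    ∃ g : Equiv.Perm V, (∀ v, Q (g v) = Q v) ∧
      ∀ u v, P u = Y → P v = Y → (G.Adj u v ↔ H.Adj (g u) (g v)) := by
  have hP := h.coarsen hQ
  obtain ⟨c, hc⟩ := hG.exists_pentagon h5 h2
  obtain ⟨c', hc'⟩ := (hP.unigraphic hG).exists_pentagon h5 fun y hy => by rw [← hP, h2 y hy]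
  have hadj : ∀ i j : Fin 5, (SimpleGraph.cycleGraph 5).Adj i j ↔ j = i + 1 ∨ j = i - 1 := by
    decide
  have key : ∀ {K L : SimpleGraph V} {b b' : Fin 5 ≃ {v // P v = Y}},
      (∀ i j, K.Adj (b i) (b j) ↔ (SimpleGraph.cycleGraph 5).Adj i j) →
      (∀ i j, L.Adj (b' i) (b' j) ↔ (SimpleGraph.cycleGraph 5).Adj i j) →
      Equitable K Q → SameDegrees K L Q → ∀ i k, Q (b i) = Q (b' k) →
      ∀ j, j = i + 1 ∨ j = i - 1 → Q (b j) = Q (b' (k + 1)) ∨ Q (b j) = Q (b' (k - 1)) := by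
    intro K L b b' hb hb' hK hKL i k hik j hj
    have h1 : 0 < cellDegree L Q (b' k) (Q (b j)) := by
      rw [← hKL, ← hK _ _ _ hik]
      exact cellDegree_pos.2 ⟨b j, (hb _ _).2 ((hadj _ _).2 hj), rfl⟩
    obtain ⟨w, hw, hw'⟩ := cellDegree_pos.1 h1
    have hwY : P w = Y := (hQ _ _ hw').trans (b j).2
    obtain ⟨t, ht⟩ := b'.surjective ⟨w, hwY⟩
    have ht' : w = b' t := by rw [ht]
    rw [ht', hb', hadj] at hw
    rw [← hw', ht']
    rcases hw with rfl | rfl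
    · exact Or.inl rfl
    · exact Or.inr rfl
  obtain ⟨d, hd, hd'⟩ := exists_dihedral (fun i => Q (c i)) (fun i => Q (c' i))
    ⟨c'.symm (c 0), by simp⟩ (fun i k hik => by
      -- Inclusions both ways between sets of at most two colors already give equality of the
      -- unordered pairs, with multiplicity.
      have k1 := key hc hc' hGQ h i k hik
      have k2 := key hc' hc (h.equitable hGQ) h.symm k i hik.symm
      have a1 := k1 (i + 1) (Or.inl rfl)
      have a2 := k1 (i - 1) (Or.inr rfl)
      have a3 := k2 (k + 1) (Or.inl rfl)
      have a4 := k2 (k - 1) (Or.inr rfl)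
      rw [Sym2.eq_iff]
      grind)
  let ρ : Equiv.Perm {v // P v = Y} := (c.symm.trans d).trans c'
  have hρ : ∀ v, Q (ρ v) = Q v := fun v => by
    simpa [ρ] using hd (c.symm v)
  refine ⟨Equiv.Perm.ofSubtype ρ, fun v => ?_, fun u v hu hv => ?_⟩
  · by_cases hv : P v = Y
    · rw [Equiv.Perm.ofSubtype_apply_of_mem (p := fun v => P v = Y) ρ hv, hρ]
    · rw [Equiv.Perm.ofSubtype_apply_of_not_mem (p := fun v => P v = Y) ρ hv]
  · rw [Equiv.Perm.ofSubtype_apply_of_mem (p := fun v => P v = Y) ρ hu,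
      Equiv.Perm.ofSubtype_apply_of_mem (p := fun v => P v = Y) ρ hv]
    have e1 := hc (c.symm ⟨u, hu⟩) (c.symm ⟨v, hv⟩)
    have e2 := hc' (d (c.symm ⟨u, hu⟩)) (d (c.symm ⟨v, hv⟩))
    rw [← hd', ← e1] at e2
    simpa [ρ] using e2.symm

/-- Inside a sparse unigraphic cell only three cases occur: a perfect matching, a pentagon, or no
edges, where the identity works. -/
theorem Unigraphic.exists_perm_cell (hG : Unigraphic G P) (hs : Sparse G P)
    (hQ : ∀ u v, Q u = Q v → P u = P v) (hGQ : Equitable G Q) (h : SameDegrees G H Q) (Y : I) :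
    ∃ g : Equiv.Perm V, (∀ v, Q (g v) = Q v) ∧
      ∀ u v, P u = Y → P v = Y → (G.Adj u v ↔ H.Adj (g u) (g v)) := by
  by_cases hY : CellsLinked G P Y Y
  · have hY' := hY
    obtain ⟨y, z, rfl, hz, hyz⟩ := hY
    have hpos : 0 < cellDegree G P y (P y) := cellDegree_pos.2 ⟨z, hyz, hz⟩
    rcases hG.cellDegree_self hs y with h1 | ⟨h5, h2⟩
    · exact exists_perm_of_matching hQ hGQ
        (fun x hx => by rw [hG.equitable x y _ hx]; omega) h
    · exact hG.exists_perm_of_pentagon hQ hGQ h h5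
        (fun x hx => by rw [hG.equitable x y _ hx, h2])
  · refine ⟨1, fun _ => rfl, fun u v hu hv => ?_⟩
    simp only [Equiv.Perm.one_apply]
    refine iff_of_false (fun huv => hY ⟨u, v, hu, hv, huv⟩) fun huv => hY ?_
    exact (h.coarsen hQ).cellsLinked ⟨u, v, hu, hv, huv⟩

theorem card_filter_pendant (hQ : ∀ u v, Q u = Q v → P u = P v) {X : I} {n : V → V} {v₀ : V}
    (h1 : ∀ y, P y = P v₀ → cellDegree G P y X = 1)
    (hn : ∀ y, P y = P v₀ → G.Adj y (n y) ∧ P (n y) = X) {x : V} (hx : P x = X) :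
    #{v | Q v = Q v₀ ∧ n v = x} = cellDegree G Q x (Q v₀) := by
  unfold cellDegree
  congr 1
  ext v
  simp only [mem_filter, mem_univ, true_and]
  constructor
  · rintro ⟨hv, rfl⟩
    exact ⟨(hn v (hQ _ _ hv)).1.symm, hv⟩
  · rintro ⟨hxv, hv⟩
    have hvY := hQ _ _ hv
    exact ⟨hv, eq_of_cellDegree_eq_one (h1 v hvY) (hn v hvY).1 (hn v hvY).2 hxv.symm hx⟩

/-- A partial isomorphism extends to a cell all of whose vertices have degree one. -/
theorem exists_perm_pendant (hQ : ∀ u v, Q u = Q v → P u = P v) (hGQ : Equitable G Q)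
    (h : SameDegrees G H Q) {X Y : I} (h1 : ∀ y, P y = Y → cellDegree G P y X = 1)
    {f : Equiv.Perm V} (hf : ∀ v, Q (f v) = Q v) :
    ∃ g : Equiv.Perm V, (∀ v, Q (g v) = Q v) ∧
      ∀ u v, P u = Y → P v = X → (G.Adj u v ↔ H.Adj (g u) (f v)) := by
  have h1' : ∀ y, P y = Y → cellDegree H P y X = 1 := fun y hy => by
    rw [← h.coarsen hQ, h1 y hy]
  have hPf : ∀ v, P (f v) = P v := fun v => hQ _ _ (hf v)
  choose! n hn using fun y (hy : P y = Y) => exists_of_cellDegree_eq_one (h1 y hy)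
  choose! n' hn' using fun y (hy : P y = Y) => exists_of_cellDegree_eq_one (h1' y hy)
  -- A vertex of `Y` attached to `x` in `G` must go to one of the same `Q`-class attached to `f x`
  -- in `H`. Outside `Y` the tag is `none` and only the class is preserved.
  obtain ⟨g, hg⟩ := exists_equiv_of_card_fiber
    (fun v => (Q v, if P v = Y then some (f (n v)) else none))
    (fun v => (Q v, if P v = Y then some (n' v) else none)) (by
      rintro ⟨j, o⟩
      simp only [Prod.mk.injEq]
      by_cases hj : ∃ v₀, Q v₀ = j ∧ P v₀ = Y
      · obtain ⟨v₀, rfl, rfl⟩ := hj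
        have hite : ∀ (v : V) (t : V), (Q v = Q v₀ ∧ (if P v = P v₀ then some t else none) = o) ↔
            (Q v = Q v₀ ∧ some t = o) := fun v t =>
          and_congr_right fun hv => by rw [if_pos (hQ _ _ hv)]
        simp only [hite]
        obtain _ | x := o
        · simp
        simp only [Option.some.injEq]
        by_cases hx : P x = X
        · rw [card_filter_pendant hQ h1' hn' hx, ← h x]
          have := card_filter_pendant (x := f.symm x) hQ h1 hn (by
            rw [← hPf, f.apply_symm_apply, hx])
          simp only [← f.eq_symm_apply, this]
          -- The two fibers have equal size because `x` and its preimage under `f` lie in the same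
          -- `Q`-class.
          exact hGQ _ _ _ (by rw [← hf, f.apply_symm_apply])
        · rw [filter_false_of_mem, filter_false_of_mem]
          · rintro v - ⟨hv, rfl⟩
            exact hx (hn' v (hQ _ _ hv)).2
          · rintro v - ⟨hv, rfl⟩
            exact hx ((hPf _).trans (hn v (hQ _ _ hv)).2)
      · have hite : ∀ (v : V) (t : V), (Q v = j ∧ (if P v = Y then some t else none) = o) ↔
            (Q v = j ∧ none = o) := fun v t =>
          and_congr_right fun hv => by rw [if_neg fun hP => hj ⟨v, hv, hP⟩]
        simp only [hite])
  simp only [Prod.mk.injEq] at hg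
  refine ⟨g, fun v => (hg v).1, fun u v hu hv => ?_⟩
  have hgu : P (g u) = Y := (hQ _ _ (hg u).1).trans hu
  have e := (hg u).2
  rw [if_pos hgu, if_pos hu, Option.some.injEq] at e
  constructor
  · intro huv
    rw [← eq_of_cellDegree_eq_one (h1 u hu) (hn u hu).1 (hn u hu).2 huv hv, ← e]
    exact (hn' _ hgu).1
  · intro huv
    have := eq_of_cellDegree_eq_one (h1' _ hgu) (hn' _ hgu).1 (hn' _ hgu).2 huv
      ((hPf v).trans hv)
    rw [e] at this
    rw [← f.injective this]
    exact (hn u hu).1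

/-- Induct on the number of cells: solve for `S` without a removable cell `Y`, choose a permutation
for `Y` separately, and glue. Edges between unlinked cells need no care, since neither `G` nor `H`
has any. -/
theorem Unigraphic.exists_perm_of_sparse (hG : Unigraphic G P) (hs : Sparse G P)
    (hQ : ∀ u v, Q u = Q v → P u = P v) (hGQ : Equitable G Q) (h : SameDegrees G H Q)
    (S : Finset I) : ∃ f : Equiv.Perm V, (∀ v, Q (f v) = Q v) ∧
      ∀ u v, P u ∈ S → P v ∈ S → (G.Adj u v ↔ H.Adj (f u) (f v)) := by
  induction hm : #S generalizing S with
  | zero =>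
    rw [card_eq_zero] at hm
    subst hm
    exact ⟨1, fun _ => rfl, by simp⟩
  | succ m ih =>
    obtain ⟨Y, hY, hrem⟩ := hG.exists_removableCell hs (S := S) (card_pos.1 (by omega))
    obtain ⟨f, hf, hf'⟩ := ih (S.erase Y) (by rw [card_erase_of_mem hY, hm]; rfl)
    have hP := h.coarsen hQ
    have hno : ∀ {g g' : Equiv.Perm V}, (∀ v, Q (g v) = Q v) → (∀ v, Q (g' v) = Q v) →
        ∀ u v, ¬ CellsLinked G P (P u) (P v) → (G.Adj u v ↔ H.Adj (g u) (g' v)) := by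
      intro g g' hg hg' u v hl
      refine iff_of_false (fun huv => hl ⟨u, v, rfl, rfl, huv⟩) fun huv => hl ?_
      exact hP.cellsLinked ⟨g u, g' v, hQ _ _ (hg u), hQ _ _ (hg' v), huv⟩
    obtain ⟨g, hg, hg1, hg2⟩ : ∃ g : Equiv.Perm V, (∀ v, Q (g v) = Q v) ∧
        (∀ u v, P u = Y → P v = Y → (G.Adj u v ↔ H.Adj (g u) (g v))) ∧
        ∀ u v, P u = Y → P v ∈ S → P v ≠ Y → (G.Adj u v ↔ H.Adj (g u) (f v)) := by
      rcases hrem with hiso | ⟨hYY, X, hX, hXY, h1, hother⟩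
      · obtain ⟨g, hg, hg'⟩ := hG.exists_perm_cell hs hQ hGQ h Y
        refine ⟨g, hg, hg', fun u v hu hv hvY => hno hg hf u v fun hl => ?_⟩
        exact hiso _ hv hvY (hu ▸ hl.symm)
      · obtain ⟨g, hg, hg'⟩ := exists_perm_pendant hQ hGQ h h1 hf
        refine ⟨g, hg, fun u v hu hv => hno hg hg u v (by rwa [hu, hv]), fun u v hu hv hvY => ?_⟩
        by_cases hvX : P v = X
        · exact hg' u v hu hvX
        · exact hno hg hf u v fun hl => hother _ hv hvY hvX (hu ▸ hl.symm)
    obtain ⟨f', hf''⟩ := exists_perm_ite (P := P) (fun v => hQ _ _ (hf v)) (fun v => hQ _ _ (hg v)) Y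
    refine ⟨f', fun v => ?_, fun u v hu hv => ?_⟩
    · rw [hf'']
      split_ifs
      exacts [hg v, hf v]
    · rw [hf'', hf'']
      split_ifs with h1 h2 h2
      · exact hg1 u v h1 h2
      · exact hg2 u v h1 hv h2
      · rw [G.adj_comm, H.adj_comm]
        exact hg2 v u h2 hu h1
      · exact hf' u v (mem_erase.2 ⟨h1, hu⟩) (mem_erase.2 ⟨h2, hv⟩)

/-- The degree parameters of an equitable refinement of the cells determine the graph as well. -/
theorem Unigraphic.refine (hG : Unigraphic G P) (hQ : ∀ u v, Q u = Q v → P u = P v)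
    (hGQ : Equitable G Q) : Unigraphic G Q := by
  refine ⟨hGQ, fun H h => ?_⟩
  -- Flips along `P` are involutions respecting degrees and isomorphisms for `Q`, so the sparse case
  -- suffices.
  obtain ⟨s, hs⟩ := hG.equitable.exists_sparse_flipCells
  obtain ⟨f, hf, hf'⟩ := (hG.flip s).exists_perm_of_sparse hs hQ (hGQ.flip s hQ) (h.flip s hQ)
    (univ.image P)
  have : CellIso (flipCells G P s) (flipCells H P s) Q :=
    ⟨f, hf, fun u v => hf' u v (by simp) (by simp)⟩
  have := this.flip s Q hQ
  rwa [flipCells_flipCells, flipCells_flipCells] at this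

end Refinement

/-! ### Syntax and semantics of counting formulas -/

namespace CountingFormula

section Formulas

variable {k : ℕ} {C V W : Type*}

theorem holds_congr_freeVars (G : SimpleGraph V) (χ : V → C) (φ : CountingFormula k C)
    {a b : Fin k → Option V} (h : ∀ i ∈ φ.freeVars, a i = b i) :
    Holds G χ φ a ↔ Holds G χ φ b := by
  induction φ generalizing a b with
  | falsum => rfl
  | eq i j => simp only [Holds, h i (by simp [freeVars]), h j (by simp [freeVars])]
  | adj i j => simp only [Holds, h i (by simp [freeVars]), h j (by simp [freeVars])]
  | color c i => simp only [Holds, h i (by simp [freeVars])]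
  | neg φ ih => exact not_congr (ih h)
  | and φ ψ ih ih' =>
    exact and_congr (ih fun i hi => h i (Or.inl hi)) (ih' fun i hi => h i (Or.inr hi))
  | existsGE t i φ ih =>
    simp only [Holds]
    have : ∀ v, Holds G χ φ (Function.update a i (some v)) ↔
        Holds G χ φ (Function.update b i (some v)) := fun v => ih fun l hl => by
      by_cases hli : l = i
      · subst hli; simp
      · rw [Function.update_of_ne hli, Function.update_of_ne hli]
        exact h l ⟨hl, hli⟩
    simp only [this]

theorem holds_map_iso {G : SimpleGraph V} {H : SimpleGraph W} {χ : V → C} {η : W → C}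
    (f : G ≃g H) (hf : ∀ v, η (f v) = χ v) (φ : CountingFormula k C) (a : Fin k → Option V) :
    Holds G χ φ a ↔ Holds H η φ fun i => (a i).map f := by
  induction φ generalizing a with
  | falsum => rfl
  | eq i j => simp [Holds]
  | adj i j => simp [Holds, f.map_adj_iff]
  | color c i => simp [Holds, hf]
  | neg φ ih => exact not_congr (ih a)
  | and φ ψ ih ih' => exact and_congr (ih a) (ih' a)
  | existsGE t i φ ih =>
    simp only [Holds]
    rw [← f.injective.encard_image]
    convert Iff.rfl
    ext w
    obtain ⟨v, rfl⟩ := f.surjective w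
    rw [f.injective.mem_set_image]
    simp only [Set.mem_ofPred_eq, ih]
    convert Iff.rfl using 2
    ext l : 1
    by_cases hl : l = i
    · subst hl; simp
    · simp [hl]

/-- Rename the variables of a formula. -/
def rename (σ : Equiv.Perm (Fin k)) : CountingFormula k C → CountingFormula k C
  | falsum => falsum
  | eq i j => eq (σ i) (σ j)
  | adj i j => adj (σ i) (σ j)
  | color c i => color c (σ i)
  | neg φ => neg (rename σ φ)
  | and φ ψ => and (rename σ φ) (rename σ ψ)
  | existsGE t i φ => existsGE t (σ i) (rename σ φ)

theorem freeVars_rename (σ : Equiv.Perm (Fin k)) (φ : CountingFormula k C) :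
    (rename σ φ).freeVars = σ '' φ.freeVars := by
  induction φ with
  | falsum => simp [rename, freeVars]
  | eq i j => simp [rename, freeVars, Set.image_pair]
  | adj i j => simp [rename, freeVars, Set.image_pair]
  | color c i => simp [rename, freeVars]
  | neg φ ih => exact ih
  | and φ ψ ih ih' => simp [rename, freeVars, ih, ih', Set.image_union]
  | existsGE t i φ ih => simp [rename, freeVars, ih, Set.image_sdiff σ.injective]

theorem holds_rename (G : SimpleGraph V) (χ : V → C) (σ : Equiv.Perm (Fin k))
    (φ : CountingFormula k C) (a : Fin k → Option V) :
    Holds G χ (rename σ φ) a ↔ Holds G χ φ (a ∘ σ) := by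
  induction φ generalizing a with
  | falsum => rfl
  | eq i j => rfl
  | adj i j => rfl
  | color c i => rfl
  | neg φ ih => exact not_congr (ih a)
  | and φ ψ ih ih' => exact and_congr (ih a) (ih' a)
  | existsGE t i φ ih =>
    simp only [rename, Holds, ih]
    have : ∀ v, Function.update a (σ i) (some v) ∘ σ = Function.update (a ∘ σ) i (some v) := by
      intro v
      ext l : 1
      by_cases hl : l = i
      · subst hl; simp
      · simp [hl]
    simp only [this]

/-- The conjunction of a list of formulas. -/
def conj (L : List (CountingFormula k C)) : CountingFormula k C := L.foldr and (neg falsum)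

theorem holds_conj (G : SimpleGraph V) (χ : V → C) (L : List (CountingFormula k C))
    (a : Fin k → Option V) : Holds G χ (conj L) a ↔ ∀ φ ∈ L, Holds G χ φ a := by
  induction L with
  | nil => simp [conj, Holds]
  | cons φ L ih =>
    rw [List.forall_mem_cons, ← ih]
    rfl

theorem freeVars_conj_subset {L : List (CountingFormula k C)} {s : Set (Fin k)}
    (h : ∀ φ ∈ L, φ.freeVars ⊆ s) : (conj L).freeVars ⊆ s := by
  induction L with
  | nil => simp [conj, freeVars]
  | cons φ L ih =>
    exact Set.union_subset (h φ (by simp)) (ih fun ψ hψ => h ψ (by simp [hψ]))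

/-- The conjunction of a finite family of formulas. -/
noncomputable def conjAll {J : Type*} [Fintype J] (f : J → CountingFormula k C) :
    CountingFormula k C := conj (Finset.univ.toList.map f)

theorem holds_conjAll {J : Type*} [Fintype J] (G : SimpleGraph V) (χ : V → C)
    (f : J → CountingFormula k C) (a : Fin k → Option V) :
    Holds G χ (conjAll f) a ↔ ∀ j, Holds G χ (f j) a := by
  simp [conjAll, holds_conj]

theorem freeVars_conjAll_subset {J : Type*} [Fintype J] {f : J → CountingFormula k C}
    {s : Set (Fin k)} (h : ∀ j, (f j).freeVars ⊆ s) : (conjAll f).freeVars ⊆ s :=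
  freeVars_conj_subset (by simpa using h)

/-- Implication. -/
def imp (φ ψ : CountingFormula k C) : CountingFormula k C := neg (and φ (neg ψ))

theorem holds_imp (G : SimpleGraph V) (χ : V → C) (φ ψ : CountingFormula k C)
    (a : Fin k → Option V) : Holds G χ (imp φ ψ) a ↔ (Holds G χ φ a → Holds G χ ψ a) := by
  simp [imp, Holds]

theorem freeVars_imp (φ ψ : CountingFormula k C) :
    (imp φ ψ).freeVars = φ.freeVars ∪ ψ.freeVars := rfl

/-- The quantifier "there are exactly `t`". -/
def existsEq (t : ℕ) (i : Fin k) (φ : CountingFormula k C) : CountingFormula k C :=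
  and (existsGE t i φ) (neg (existsGE (t + 1) i φ))

theorem holds_existsEq (G : SimpleGraph V) (χ : V → C) (t : ℕ) (i : Fin k)
    (φ : CountingFormula k C) (a : Fin k → Option V) : Holds G χ (existsEq t i φ) a ↔
      Set.encard {v : V | Holds G χ φ (Function.update a i (some v))} = t := by
  simp only [existsEq, Holds, not_le]
  rw [Nat.cast_add, Nat.cast_one, ENat.lt_add_one_iff (ENat.natCast_ne_top t)]
  exact ⟨fun h => le_antisymm h.2 h.1, fun h => ⟨h.ge, h.le⟩⟩

theorem freeVars_existsEq (t : ℕ) (i : Fin k) (φ : CountingFormula k C) :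
    (existsEq t i φ).freeVars = φ.freeVars \ {i} := Set.union_self _

end Formulas

/-! ### Two-variable formulas with one free variable -/

section TwoVariables

variable {C V : Type*}

/-- Satisfaction of a formula whose only free variable is `x₀`. -/
def HoldsAt (G : SimpleGraph V) (χ : V → C) (φ : CountingFormula 2 C) (v : V) : Prop :=
  Holds G χ φ (Function.update (fun _ => none) 0 (some v))

theorem holds_iff_holdsAt (G : SimpleGraph V) (χ : V → C) {φ : CountingFormula 2 C}
    (hφ : φ.freeVars ⊆ {0}) {a : Fin 2 → Option V} {v : V} (ha : a 0 = some v) :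
    Holds G χ φ a ↔ HoldsAt G χ φ v :=
  holds_congr_freeVars G χ φ fun i hi => by
    obtain rfl := hφ hi
    simp [ha]

/-- The formula `φ(x₁)`, for a formula `φ(x₀)`. -/
def shift (φ : CountingFormula 2 C) : CountingFormula 2 C := rename (Equiv.swap 0 1) φ

theorem holds_shift (G : SimpleGraph V) (χ : V → C) {φ : CountingFormula 2 C}
    (hφ : φ.freeVars ⊆ {0}) {a : Fin 2 → Option V} {v : V} (ha : a 1 = some v) :
    Holds G χ (shift φ) a ↔ HoldsAt G χ φ v := by
  rw [shift, holds_rename, holds_iff_holdsAt G χ hφ]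
  simpa using ha

theorem freeVars_shift_subset {φ : CountingFormula 2 C} (hφ : φ.freeVars ⊆ {0}) :
    (shift φ).freeVars ⊆ {1} := by
  rw [shift, freeVars_rename]
  rintro _ ⟨i, hi, rfl⟩
  obtain rfl := hφ hi
  simp

theorem holdsAt_neighbors (G : SimpleGraph V) (χ : V → C) {φ : CountingFormula 2 C}
    (hφ : φ.freeVars ⊆ {0}) (v w : V) :
    Holds G χ (and (adj 0 1) (shift φ))
      (Function.update (Function.update (fun _ => none) 0 (some v)) 1 (some w)) ↔
      G.Adj v w ∧ HoldsAt G χ φ w := by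
  refine and_congr ?_ (holds_shift G χ hφ (by simp))
  simp [Holds]

theorem freeVars_neighbors_subset {φ : CountingFormula 2 C} (hφ : φ.freeVars ⊆ {0}) :
    (and (adj 0 1) (shift φ)).freeVars \ {1} ⊆ {0} := by
  rintro i ⟨hi | hi, hi'⟩
  · rcases hi with rfl | rfl
    · rfl
    · exact absurd rfl hi'
  · exact absurd (freeVars_shift_subset hφ hi) hi'

/-- The sentence `∀ x₀, φ(x₀)`. -/
def forallVertex (φ : CountingFormula 2 C) : CountingFormula 2 C := neg (existsGE 1 0 (neg φ))

theorem models_forallVertex (G : SimpleGraph V) (χ : V → C) (φ : CountingFormula 2 C) :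
    Models G χ (forallVertex φ) ↔ ∀ v, HoldsAt G χ φ v := by
  simp only [Models, forallVertex, Holds, HoldsAt]
  rw [Nat.cast_one, Set.one_le_encard_iff_nonempty, Set.not_nonempty_iff_eq_empty,
    Set.eq_empty_iff_forall_notMem]
  simp

end TwoVariables

end CountingFormula

/-! ### Degree parameters determine the two-variable theory -/

section Invariance

open scoped Classical
open Finset CountingFormula

variable {V I C : Type*} [Fintype V] {G H : SimpleGraph V} {P : V → I} {χ : V → C}

/-- The number of vertices of each atomic type over `p` depends only on the cell of `p` and its
degrees. -/
theorem card_fiber_adj (G : SimpleGraph V) (P : V → I) (p : V) (c : I) (A B : Prop) :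
    #{v | (P v, v = p, G.Adj p v) = (c, A, B)} =
      if A then (if B then 0 else if P p = c then 1 else 0)
      else if B then cellDegree G P p c else cellOthers P p c - cellDegree G P p c := by
  simp only [Prod.mk.injEq, eq_iff_iff]
  by_cases hA : A <;> by_cases hB : B <;> simp only [hA, hB, iff_true, iff_false, if_true, if_false]
  · rw [card_eq_zero, filter_eq_empty_iff]
    rintro v - ⟨-, rfl, h⟩
    exact h.ne rfl
  · split_ifs with h
    · rw [card_eq_one]
      refine ⟨p, ?_⟩
      ext v
      simp only [mem_filter, mem_univ, true_and, mem_singleton]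
      constructor
      · exact fun h => h.2.1
      · rintro rfl
        exact ⟨h, rfl, G.irrefl⟩
    · rw [card_eq_zero, filter_eq_empty_iff]
      rintro v - ⟨h', rfl, -⟩
      exact h h'
  · unfold cellDegree
    congr 1
    ext v
    simp only [mem_filter, mem_univ, true_and]
    constructor
    · exact fun h => ⟨h.2.2, h.1⟩
    · exact fun h => ⟨h.2, h.1.ne.symm, h.1⟩
  · unfold cellDegree cellOthers
    rw [← card_sdiff_of_subset]
    · congr 1
      ext v
      simp only [mem_filter, mem_univ, true_and, mem_sdiff]
      tauto
    · intro v
      simp only [mem_filter, mem_univ, true_and]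
      exact fun h => ⟨h.1.ne.symm, h.2⟩

/-- The duplicator's answer in the bijective two-pebble game: a bijection keeping the cell and the
atomic type relative to the pebbles `p`, `q`. -/
theorem SameDegrees.exists_equiv (h : SameDegrees G H P) (hG : Equitable G P) {p q : V}
    (hpq : P p = P q) : ∃ e : Equiv.Perm V, ∀ v, P (e v) = P v ∧ (e v = q ↔ v = p) ∧
      (H.Adj q (e v) ↔ G.Adj p v) := by
  obtain ⟨e, he⟩ := exists_equiv_of_card_fiber (fun v => (P v, v = p, G.Adj p v))
    (fun v => (P v, v = q, H.Adj q v)) (by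
      rintro ⟨c, A, B⟩
      rw [card_fiber_adj, card_fiber_adj, ← h q, hG p q c hpq, cellOthers_congr hpq, hpq])
  refine ⟨e, fun v => ?_⟩
  simpa using he v

/-- Assignments to two variables that cannot be distinguished by atomic formulas. -/
def AssignmentsMatch (G H : SimpleGraph V) (P : V → I) (a b : Fin 2 → Option V) : Prop :=
  ∀ i j, (a i).map P = (b i).map P ∧
    ∀ u v u' v', a i = some u → a j = some v → b i = some u' → b j = some v' →
      (u = v ↔ u' = v') ∧ (G.Adj u v ↔ H.Adj u' v')

theorem AssignmentsMatch.exists_some {a b : Fin 2 → Option V} (hab : AssignmentsMatch G H P a b)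
    {i : Fin 2} {u : V} (hu : a i = some u) : ∃ u', b i = some u' ∧ P u' = P u := by
  have := (hab i i).1
  rw [hu, Option.map_some, eq_comm, Option.map_eq_some_iff] at this
  exact this

theorem AssignmentsMatch.symm {a b : Fin 2 → Option V} (hab : AssignmentsMatch G H P a b) :
    AssignmentsMatch H G P b a := fun i j =>
  ⟨(hab i j).1.symm, fun u v u' v' h1 h2 h3 h4 =>
    ⟨((hab i j).2 u' v' u v h3 h4 h1 h2).1.symm, ((hab i j).2 u' v' u v h3 h4 h1 h2).2.symm⟩⟩

theorem AssignmentsMatch.exists_iff {a b : Fin 2 → Option V} (hab : AssignmentsMatch G H P a b)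
    {i j : Fin 2} {p q : V → V → Prop} (hpq : ∀ u v u' v', a i = some u → a j = some v →
      b i = some u' → b j = some v' → (p u v ↔ q u' v')) :
    (∃ u v, a i = some u ∧ a j = some v ∧ p u v) ↔
      ∃ u v, b i = some u ∧ b j = some v ∧ q u v := by
  constructor
  · rintro ⟨u, v, hu, hv, huv⟩
    obtain ⟨u', hu', -⟩ := hab.exists_some hu
    obtain ⟨v', hv', -⟩ := hab.exists_some hv
    exact ⟨u', v', hu', hv', (hpq _ _ _ _ hu hv hu' hv').1 huv⟩
  · rintro ⟨u, v, hu, hv, huv⟩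
    obtain ⟨u', hu', -⟩ := hab.symm.exists_some hu
    obtain ⟨v', hv', -⟩ := hab.symm.exists_some hv
    exact ⟨u', v', hu', hv', (hpq _ _ _ _ hu' hv' hu hv).2 huv⟩

/-- Reassigning `x_i` leaves one other variable. If it has a value, the bijection over that value
works, otherwise the identity does. -/
theorem AssignmentsMatch.exists_extend (h : SameDegrees G H P) (hG : Equitable G P)
    {a b : Fin 2 → Option V} (hab : AssignmentsMatch G H P a b) (i : Fin 2) :
    ∃ e : Equiv.Perm V, ∀ v, AssignmentsMatch G H P (Function.update a i (some v))
      (Function.update b i (some (e v))) := by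
  obtain ⟨j, hij, hj⟩ : ∃ j, i ≠ j ∧ ∀ l, l = i ∨ l = j := by
    fin_cases i
    · exact ⟨1, by decide, by decide⟩
    · exact ⟨0, by decide, by decide⟩
  obtain ⟨e, he, he'⟩ : ∃ e : Equiv.Perm V, (∀ v, P (e v) = P v) ∧
      ∀ p q, a j = some p → b j = some q → ∀ v, (e v = q ↔ v = p) ∧
        (H.Adj q (e v) ↔ G.Adj p v) := by
    rcases hp : a j with _ | p
    · exact ⟨1, fun _ => rfl, by simp⟩
    · obtain ⟨q, hq, hpq⟩ := hab.exists_some hp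
      obtain ⟨e, he⟩ := h.exists_equiv hG hpq.symm
      refine ⟨e, fun v => (he v).1, fun p' q' hp' hq' v => ?_⟩
      rw [hq] at hq'
      obtain rfl := Option.some.inj hp'
      obtain rfl := Option.some.inj hq'
      exact (he v).2
  refine ⟨e, fun v l m => ⟨?_, ?_⟩⟩
  · rcases hj l with rfl | rfl
    · simp [he]
    · rw [Function.update_of_ne hij.symm, Function.update_of_ne hij.symm]
      exact (hab l l).1
  · intro u w u' w' h1 h2 h3 h4
    rcases hj l with rfl | rfl <;> rcases hj m with rfl | rfl
    · rw [Function.update_self, Option.some.injEq] at h1 h2 h3 h4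
      subst h1 h2 h3 h4
      simp
    · rw [Function.update_self, Option.some.injEq] at h1 h3
      rw [Function.update_of_ne hij.symm] at h2 h4
      subst h1 h3
      obtain ⟨k1, k2⟩ := he' w w' h2 h4 v
      exact ⟨k1.symm, by rw [G.adj_comm, H.adj_comm]; exact k2.symm⟩
    · rw [Function.update_self, Option.some.injEq] at h2 h4
      rw [Function.update_of_ne hij.symm] at h1 h3
      subst h2 h4
      obtain ⟨k1, k2⟩ := he' u u' h1 h3 v
      exact ⟨by rw [eq_comm, ← k1, eq_comm], k2.symm⟩
    · rw [Function.update_of_ne hij.symm] at h1 h2 h3 h4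
      exact (hab _ _).2 u w u' w' h1 h2 h3 h4

/-- Graphs with a common equitable partition satisfy the same formulas with two variables. -/
theorem SameDegrees.holds_iff (h : SameDegrees G H P) (hG : Equitable G P)
    (hχ : ∀ u v, P u = P v → χ u = χ v) (φ : CountingFormula 2 C) {a b : Fin 2 → Option V}
    (hab : AssignmentsMatch G H P a b) : Holds G χ φ a ↔ Holds H χ φ b := by
  induction φ generalizing a b with
  | falsum => rfl
  | eq i j => exact hab.exists_iff fun u v u' v' h1 h2 h3 h4 => ((hab i j).2 u v u' v' h1 h2 h3 h4).1
  | adj i j => exact hab.exists_iff fun u v u' v' h1 h2 h3 h4 => ((hab i j).2 u v u' v' h1 h2 h3 h4).2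
  | color c i =>
    constructor
    · rintro ⟨u, hu, rfl⟩
      obtain ⟨u', hu', hP⟩ := hab.exists_some hu
      exact ⟨u', hu', hχ _ _ hP⟩
    · rintro ⟨u, hu, rfl⟩
      obtain ⟨u', hu', hP⟩ := hab.symm.exists_some hu
      exact ⟨u', hu', hχ _ _ hP⟩
  | neg φ ih => exact not_congr (ih hab)
  | and φ ψ ih ih' => exact and_congr (ih hab) (ih' hab)
  | existsGE t i φ ih =>
    -- `e` maps the witnesses in `G` onto those in `H`, so all counting thresholds agree.
    obtain ⟨e, he⟩ := hab.exists_extend h hG i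
    simp only [Holds]
    rw [← e.injective.encard_image]
    convert Iff.rfl
    ext w
    obtain ⟨v, rfl⟩ := e.surjective w
    rw [e.injective.mem_set_image]
    exact (ih (he v)).symm

theorem SameDegrees.holdsAt_iff (h : SameDegrees G H P) (hG : Equitable G P)
    (hχ : ∀ u v, P u = P v → χ u = χ v) (φ : CountingFormula 2 C) {u v : V} (huv : P u = P v) :
    HoldsAt G χ φ u ↔ HoldsAt H χ φ v := by
  refine h.holds_iff hG hχ φ fun i j => ⟨?_, fun x y x' y' h1 h2 h3 h4 => ?_⟩
  · fin_cases i <;> simp [huv]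
  · fin_cases i <;> fin_cases j <;> simp at h1 h2 h3 h4
    subst h1 h2 h3 h4
    simp

end Invariance

/-! ### The partition into types is the coarsest equitable refinement of the coloring -/

section Types

open scoped Classical
open Finset CountingFormula

variable {V C : Type*} [Fintype V]

/-- The set of formulas with one free variable that hold at a vertex. -/
def vertexType (G : SimpleGraph V) (χ : V → C) (v : V) : Set (CountingFormula 2 C) :=
  {φ | φ.freeVars ⊆ {0} ∧ HoldsAt G χ φ v}

theorem vertexType_eq_of_forall {G : SimpleGraph V} {χ : V → C} {u v : V}
    (h : ∀ φ : CountingFormula 2 C, φ.freeVars ⊆ {0} → (HoldsAt G χ φ u ↔ HoldsAt G χ φ v)) :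
    vertexType G χ u = vertexType G χ v :=
  Set.ext fun φ => and_congr_right fun hφ => h φ hφ

theorem holdsAt_iff_of_vertexType_eq {G : SimpleGraph V} {χ : V → C} {u v : V}
    (h : vertexType G χ u = vertexType G χ v) {φ : CountingFormula 2 C} (hφ : φ.freeVars ⊆ {0}) :
    HoldsAt G χ φ u ↔ HoldsAt G χ φ v := by
  exact ⟨fun hu => ((Set.ext_iff.1 h φ).1 ⟨hφ, hu⟩).2, fun hv => ((Set.ext_iff.1 h φ).2 ⟨hφ, hv⟩).2⟩

theorem color_eq_of_vertexType_eq {G : SimpleGraph V} {χ : V → C} {u v : V}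
    (h : vertexType G χ u = vertexType G χ v) : χ u = χ v := by
  have := holdsAt_iff_of_vertexType_eq h (φ := .color (χ v) 0) (by simp [freeVars])
  simpa [HoldsAt, Holds] using this

/-- There are finitely many vertices: take the conjunction over all `u` of one formula that holds at
`v` and, when the types differ, fails at `u`. -/
theorem exists_isolating_formula (G : SimpleGraph V) (χ : V → C) (v : V) :
    ∃ τ : CountingFormula 2 C, τ.freeVars ⊆ {0} ∧
      ∀ u, HoldsAt G χ τ u ↔ vertexType G χ u = vertexType G χ v := by
  have hδ : ∀ u, ∃ δ : CountingFormula 2 C, δ.freeVars ⊆ {0} ∧ HoldsAt G χ δ v ∧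
      (HoldsAt G χ δ u → vertexType G χ u = vertexType G χ v) := by
    intro u
    by_cases h : vertexType G χ u = vertexType G χ v
    · exact ⟨neg falsum, by simp [freeVars], id, fun _ => h⟩
    · obtain ⟨φ, hφ, hne⟩ : ∃ φ : CountingFormula 2 C, φ.freeVars ⊆ {0} ∧
          ¬ (HoldsAt G χ φ u ↔ HoldsAt G χ φ v) := by
        by_contra! hall
        exact h (vertexType_eq_of_forall hall)
      by_cases hv : HoldsAt G χ φ v
      · exact ⟨φ, hφ, hv, fun hu => absurd (iff_of_true hu hv) hne⟩
      · exact ⟨neg φ, hφ, hv, fun hu => absurd (iff_of_false hu hv) hne⟩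
  choose δ h1 h2 h3 using hδ
  refine ⟨conjAll δ, freeVars_conjAll_subset h1, fun u => ?_⟩
  rw [HoldsAt, holds_conjAll]
  exact ⟨fun h => h3 u (h u), fun h w => (holdsAt_iff_of_vertexType_eq h (h1 w)).2 (h2 w)⟩

theorem exists_isolating_formulas (G : SimpleGraph V) (χ : V → C) :
    ∃ τ : Set.range (vertexType G χ) → CountingFormula 2 C, (∀ j, (τ j).freeVars ⊆ {0}) ∧
      ∀ j v, HoldsAt G χ (τ j) v ↔ vertexType G χ v = j := by
  have : ∀ j : Set.range (vertexType G χ), ∃ τ : CountingFormula 2 C, τ.freeVars ⊆ {0} ∧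
      ∀ u, HoldsAt G χ τ u ↔ vertexType G χ u = j := by
    rintro ⟨_, v, rfl⟩
    exact exists_isolating_formula G χ v
  choose τ h1 h2 using this
  exact ⟨τ, h1, h2⟩

theorem encard_neighbors (G : SimpleGraph V) {J : Type*} (P : V → J) (v : V) (c : J) :
    Set.encard {w | G.Adj v w ∧ P w = c} = cellDegree G P v c := by
  unfold cellDegree
  rw [← Set.encard_coe_eq_coe_finsetCard]
  congr 1
  ext
  simp

/-- The number of neighbors satisfying an isolating formula is expressible by a formula in `x₀`,
hence part of the type. -/
theorem equitable_vertexType (G : SimpleGraph V) (χ : V → C) : Equitable G (vertexType G χ) := by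
  intro u v c huv
  by_cases hc : ∃ w, vertexType G χ w = c
  · obtain ⟨w, rfl⟩ := hc
    obtain ⟨τ, hτ, hτ'⟩ := exists_isolating_formula G χ w
    have key : ∀ x, HoldsAt G χ (existsEq (cellDegree G (vertexType G χ) u (vertexType G χ w)) 1
        (and (adj 0 1) (shift τ))) x ↔ cellDegree G (vertexType G χ) x (vertexType G χ w) =
          cellDegree G (vertexType G χ) u (vertexType G χ w) := by
      intro x
      rw [HoldsAt, holds_existsEq]
      simp only [holdsAt_neighbors G χ hτ, hτ']
      rw [encard_neighbors, Nat.cast_inj]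
    have := holdsAt_iff_of_vertexType_eq huv (φ := existsEq
      (cellDegree G (vertexType G χ) u (vertexType G χ w)) 1 (and (adj 0 1) (shift τ))) (by
      rw [freeVars_existsEq]
      exact freeVars_neighbors_subset hτ)
    rw [key, key] at this
    exact (this.1 rfl).symm
  · have hz : ∀ x, cellDegree G (vertexType G χ) x c = 0 := fun x => by
      by_contra h0
      obtain ⟨u, -, hu⟩ := cellDegree_pos.1 (Nat.pos_of_ne_zero h0)
      exact hc ⟨u, hu⟩
    rw [hz, hz]

/-- Maximality of the type partition, obtained from invariance by comparing `G` with itself. -/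
theorem vertexType_eq_of_equitable {G : SimpleGraph V} {χ : V → C} {J : Type*} {Q : V → J}
    (hG : Equitable G Q) (hχ : ∀ u v, Q u = Q v → χ u = χ v) {u v : V} (huv : Q u = Q v) :
    vertexType G χ u = vertexType G χ v :=
  vertexType_eq_of_forall fun φ _ =>
    SameDegrees.holdsAt_iff (fun _ _ => rfl) hG hχ φ huv

end Types

/-! ### Identification by two-variable counting logic is unigraphicity of the type partition -/

section Identification

open scoped Classical
open Finset CountingFormula

/-- A graph with the same degrees satisfies the identifying sentence, so it is isomorphic to `G`.
The isomorphism keeps cells because types are isomorphism invariant and every vertex satisfies the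
same formulas in both graphs. -/
theorem IsIdentified.unigraphic {V C : Type*} [Fintype V] {G : SimpleGraph V} {χ : V → C}
    (hG : IsIdentified 2 G χ) : Unigraphic G (vertexType G χ) := by
  obtain ⟨φ, -, hφ, hφ'⟩ := hG
  have hE := equitable_vertexType G χ
  refine ⟨hE, fun H h => ?_⟩
  have hχ : ∀ u v, vertexType G χ u = vertexType G χ v → χ u = χ v :=
    fun u v => color_eq_of_vertexType_eq
  have hH : Models H χ φ :=
    (h.holds_iff hE hχ φ fun i j => ⟨rfl, fun _ _ _ _ h => by simp at h⟩).1 hφ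
  obtain ⟨f, hf⟩ := hφ' V H χ hH
  have hP : ∀ v, vertexType G χ (f v) = vertexType G χ v := fun v =>
    vertexType_eq_of_forall fun ψ hψ => by
      rw [h.holdsAt_iff hE hχ ψ (rfl : vertexType G χ v = vertexType G χ v), HoldsAt, HoldsAt,
        holds_map_iso f hf]
      exact (holds_iff_holdsAt G χ hψ (by simp)).symm
  refine ⟨f.symm.toEquiv, fun v => ?_, fun u v => (f.symm.map_adj_iff).symm⟩
  have := hP (f.symm v)
  rw [f.apply_symm_apply] at this
  exact this.symm

variable {V C J : Type*} [Fintype J]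

/-- The sentence that the formulas `τ j` define a partition into cells of color `c j` and size
`s j`, with degree parameters `d`. -/
noncomputable def cellSentence (τ : J → CountingFormula 2 C) (c : J → C) (s : J → ℕ)
    (d : J → J → ℕ) : CountingFormula 2 C :=
  and (conjAll fun j => existsEq (s j) 0 (τ j)) <|
    forallVertex <| and (neg (conjAll fun j => neg (τ j))) <| conjAll fun j => imp (τ j) <|
      and (color (c j) 0) <| conjAll fun l => and (if j = l then neg falsum else neg (τ l)) <|
        existsEq (d j l) 1 (and (adj 0 1) (shift (τ l)))

theorem isSentence_cellSentence {τ : J → CountingFormula 2 C} (hτ : ∀ j, (τ j).freeVars ⊆ {0})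
    (c : J → C) (s : J → ℕ) (d : J → J → ℕ) : (cellSentence τ c s d).IsSentence := by
  refine Set.subset_empty_iff.1 (Set.union_subset ?_ ?_)
  · refine freeVars_conjAll_subset fun j => ?_
    rw [freeVars_existsEq]
    exact Set.sdiff_subset_iff.2 (by simpa using hτ j)
  · refine Set.sdiff_subset_iff.2 ?_
    rw [Set.union_empty]
    refine Set.union_subset (freeVars_conjAll_subset hτ) (freeVars_conjAll_subset fun j => ?_)
    rw [freeVars_imp]
    refine Set.union_subset (hτ j) (Set.union_subset (by simp [freeVars])
      (freeVars_conjAll_subset fun l => Set.union_subset ?_ ?_))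
    · split_ifs
      · simp [freeVars]
      · exact hτ l
    · rw [freeVars_existsEq]
      exact freeVars_neighbors_subset (hτ l)

theorem models_cellSentence {τ : J → CountingFormula 2 C} (hτ : ∀ j, (τ j).freeVars ⊆ {0})
    (c : J → C) (s : J → ℕ) (d : J → J → ℕ) (G : SimpleGraph V) (χ : V → C) :
    Models G χ (cellSentence τ c s d) ↔
      (∀ j, Set.encard {v | HoldsAt G χ (τ j) v} = s j) ∧ ∀ v, (∃ j, HoldsAt G χ (τ j) v) ∧
        ∀ j, HoldsAt G χ (τ j) v → χ v = c j ∧ ∀ l, (j ≠ l → ¬ HoldsAt G χ (τ l) v) ∧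
          Set.encard {w | G.Adj v w ∧ HoldsAt G χ (τ l) w} = d j l := by
  refine and_congr ?_ ((models_forallVertex G χ _).trans (forall_congr' fun v => ?_))
  · rw [holds_conjAll]
    exact forall_congr' fun j => holds_existsEq _ _ _ _ _ _
  · refine and_congr ?_ ?_
    · refine (not_congr (holds_conjAll _ _ _ _)).trans ?_
      simp [Holds, HoldsAt]
    · rw [holds_conjAll]
      refine forall_congr' fun j => ?_
      rw [holds_imp]
      refine imp_congr Iff.rfl (and_congr (by simp [Holds]) ?_)
      rw [holds_conjAll]
      refine forall_congr' fun l => and_congr ?_ ?_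
      · split_ifs with h
        · simp [Holds, h]
        · simp [Holds, HoldsAt, h]
      · rw [holds_existsEq]
        simp only [holdsAt_neighbors G χ (hτ l)]

theorem encard_cell [Fintype V] {I : Type*} (P : V → I) (c : I) :
    Set.encard {v | P v = c} = cellSize P c := by
  unfold cellSize
  rw [← Set.encard_coe_eq_coe_finsetCard]
  congr 1
  ext
  simp

/-- Unigraphicity concerns graphs on one vertex set, so `H` is first pulled back to `V` along an
arbitrary bijection that matches cells. -/
theorem coloredIso_of_cells {W I : Type*} [Fintype V] [Fintype W] {G : SimpleGraph V} {χ : V → C}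
    {Q : V → I} (hG : Unigraphic G Q) {H : SimpleGraph W} {η : W → C} {π : W → I}
    (hsize : ∀ c, cellSize Q c = cellSize π c)
    (hdeg : ∀ v w c, Q v = π w → cellDegree G Q v c = cellDegree H π w c)
    (hcol : ∀ v w, Q v = π w → χ v = η w) : ColoredIso H η G χ := by
  obtain ⟨b, hb⟩ := exists_equiv_of_card_fiber Q π hsize
  obtain ⟨f, hf, hf'⟩ := hG.cellIso (H.comap b) fun v c => by
    rw [hdeg v (b v) c (hb v).symm]
    unfold cellDegree
    refine (card_equiv b fun u => ?_).symm
    simp [hb]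
  refine ⟨(⟨f.trans b, @fun u v => (hf' u v).symm⟩ : G ≃g H).symm, fun w => ?_⟩
  refine hcol _ _ ?_
  have h1 := hf (f.symm (b.symm w))
  have h2 := hb (b.symm w)
  rw [f.apply_symm_apply] at h1
  rw [b.apply_symm_apply] at h2
  exact h1.symm.trans h2.symm

/-- The identifying sentence records color, size and degrees of every cell by means of isolating
formulas. In any model these formulas define a partition with the same parameters. -/
theorem Unigraphic.isIdentified [Fintype V] {G : SimpleGraph V} {χ : V → C}
    (hG : Unigraphic G (vertexType G χ)) : IsIdentified 2 G χ := by
  obtain ⟨τ, hτ, hτ'⟩ := exists_isolating_formulas G χ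
  have hc : ∀ j : Set.range (vertexType G χ), ∃ v, vertexType G χ v = j := fun j => j.2
  choose r hr using hc
  refine ⟨cellSentence τ (fun j => χ (r j)) (fun j => cellSize (vertexType G χ) j)
    (fun j l => cellDegree G (vertexType G χ) (r j) l), isSentence_cellSentence hτ _ _ _, ?_, ?_⟩
  · rw [models_cellSentence hτ]
    simp only [hτ']
    refine ⟨fun j => encard_cell _ _, fun v => ⟨⟨⟨_, v, rfl⟩, rfl⟩, fun j hj => ⟨?_, fun l =>
      ⟨fun hjl h => hjl (Subtype.ext (hj.symm.trans h)), ?_⟩⟩⟩⟩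
    · exact color_eq_of_vertexType_eq (hj.trans (hr j).symm)
    · rw [encard_neighbors, hG.equitable v (r j) l (hj.trans (hr j).symm)]
  · intro W _ H η hH
    have := Fintype.ofFinite W
    rw [models_cellSentence hτ] at hH
    obtain ⟨h1, h2⟩ := hH
    choose π hπ using fun w => (h2 w).1
    have h3 := fun w => (h2 w).2
    have hπ' : ∀ w j, HoldsAt H η (τ j) w ↔ (π w : Set (CountingFormula 2 C)) = j := by
      intro w j
      constructor
      · intro h
        by_contra hne
        exact ((h3 w _ (hπ w)).2 j).1 (fun h' => hne (congrArg _ h')) h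
      · intro h
        rw [← Subtype.ext h]
        exact hπ w
    simp only [hπ'] at h1 h3
    refine coloredIso_of_cells hG (π := fun w => (π w : Set (CountingFormula 2 C))) (fun c => ?_)
      (fun v w c hvw => ?_) fun v w hvw => ?_
    · by_cases h : c ∈ Set.range (vertexType G χ)
      · have := h1 ⟨c, h⟩
        rw [encard_cell, Nat.cast_inj] at this
        exact this.symm
      -- Labels that are not types of `G` name empty cells on both sides.
      · unfold cellSize
        exact (card_eq_zero.2 (filter_eq_empty_iff.2 fun v _ hv => h ⟨v, hv⟩)).trans
          (card_eq_zero.2 (filter_eq_empty_iff.2 fun w _ hw => h (by rw [← hw]; exact (π w).2))).symm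
    · by_cases h : c ∈ Set.range (vertexType G χ)
      · have := ((h3 w (π w) rfl).2 ⟨c, h⟩).2
        rw [encard_neighbors, Nat.cast_inj] at this
        rw [this]
        exact hG.equitable _ _ _ (hvw.trans (hr _).symm)
      · unfold cellDegree
        exact (card_eq_zero.2 (filter_eq_empty_iff.2 fun v _ hv => h ⟨v, hv.2⟩)).trans
          (card_eq_zero.2 (filter_eq_empty_iff.2 fun w _ hw =>
            h (by rw [← hw.2]; exact (π w).2))).symm
    · rw [(h3 w (π w) rfl).1]
      exact color_eq_of_vertexType_eq (hvw.trans (hr _).symm)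

end Identification

/-- The types of `χ'` are equitable and refine `χ`, so by maximality they refine the types of `χ`.
-/
theorem mainTheorem6 {V C C' : Type*} [Finite V] (G : SimpleGraph V) (χ : V → C) (χ' : V → C')
    (hfiner : ∀ u v : V, χ' u = χ' v → χ u = χ v) (hG : IsIdentified 2 G χ) :
    IsIdentified 2 G χ' := by
  have := Fintype.ofFinite V
  have hE := equitable_vertexType G χ'
  exact (hG.unigraphic.refine (fun u v h => vertexType_eq_of_equitable hE
    (fun u v h => hfiner u v (color_eq_of_vertexType_eq h)) h) hE).isIdentified
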